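/- Let $X=(X_n)_{n\ge 0}$ be a Markov chain on a finite set $\mathcal S$ with transition matrix $K$, let $((\xi_n,\eta_n))_{n\ge1}$ be i.i.d. $\mathbb R^2$-valued random vectors independent of $X$ (the two coordinates may be dependent), and let $\gamma,\lambda:\mathcal S\times\mathbb R\to\mathbb R$ be measurable in the second variable with $\lambda\ge 0$ and $P(\lambda(x,\eta_1)>0)>0$ for at least one $x\in\mathcal S$. Put $\chi(x,\theta)=\log E e^{\theta\gamma(x,\xi_1)}$, $Q_\theta(x,y)=K(x,y)e^{\chi(y,\theta)}$, and let $e^{\psi(\theta)}$ be the Perron–Frobenius eigenvalue (spectral radius) of $Q_\theta$, with $\psi(\theta)=\infty$ if some $\chi(y,\theta)=\infty$. Assume: 1. $K$ is irreducible and $\sup_{x\in\mathcal S,\theta\in\mathcal N}E e^{\theta\gamma(x,\xi_1)}<\infty$ for some neighborhood $\mathcal N$ of $0$. 2. There is $\theta_*>0$ with $\psi(\theta_*)=0$, and $\psi(\theta)<\infty$ for some $\theta>\theta_*$. 3. $\sup_{x\in\mathcal S}E_x[\lambda(X_1,\eta_1)^\alpha]<\infty$ for every $\alpha\in(0,\infty)$.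 4. $\mathrm{Var}(\gamma(x,\xi_1))>0$ for every $x\in\mathcal S$. For $\theta\in(0,\theta_*]$ let $u_\theta$ be a strictly positive vector with $Q_\theta u_\theta=e^{\psi(\theta)}u_\theta$, normalized so that $\theta\mapsto u_\theta$ is left-continuous at $\theta_*$. Let $B_1,B_2>0$ be constants, and for $0<\Delta<1$ with $1/\log(1/\Delta)<\theta_*$ put $$\rho_\Delta=\frac1{\log(1/\Delta)},\qquad c_\Delta=\frac{B_2}{B_1}\,\rho_\Delta^{-\left(1+\frac1{2\theta_*-\rho_\Delta}\right)},\qquad b_\Delta(x)=c_\Delta\,\Delta\,\bigl(u_{\theta_*}(x)\,u_{\theta_*-\rho_\Delta}(x)\bigr)^{\frac1{2\theta_*-\rho_\Delta}} .$$ The state-dependent sampler is the Markov chain $Y_n=(X_n,Z_n)$ on $\mathcal S\times\mathbb R$, started at $Y_0=y_0=(x_0,z_0)$, with $$Z_{n+1}=Z_n e^{-\gamma(X_{n+1},\xi_{n+1})}-\Delta\,\lambda(X_{n+1},\eta_{n+1}),$$ where, given $Y_n=(x,z)$: if $z>b_\Delta(x)$, then $X_{n+1}=y$ is drawn with probability $K(x,y)e^{\chi(y,\theta_*)-\psi(\theta_*)}u_{\theta_*}(y)/u_{\theta_*}(x)$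 and, given $X_{n+1}=y$, the pair $(\xi_{n+1},\eta_{n+1})$ is drawn from its nominal law tilted by the density $e^{\theta_*\gamma(y,\xi)-\chi(y,\theta_*)}$; if $z\le b_\Delta(x)$, then $X_{n+1}$ and $(\xi_{n+1},\eta_{n+1})$ are drawn from their nominal laws. The sampler terminates when $Z_n\le0$; let $T_B=\inf\{n>0: Z_n\le 0\}$, and let $P^{\theta_*}_{y_0}$, $E^{\theta_*}_{y_0}$ be the law and expectation of this chain. Then $P^{\theta_*}_{y_0}(T_B<\infty)=1$ for every such $\Delta$ and every $y_0=(x_0,z_0)$. Moreover there is $p>0$ such that for every $y_0$, as $\Delta\downarrow0$, $$E^{\theta_*}_{y_0}[T_B]=O\!\left(c_\Delta^{\,p}\log c_\Delta+\log\frac1{c_\Delta\Delta}\right),$$ where $p$ does not depend on $y_0$ or $\Delta$, and the implied constant does not depend on $\Delta$. In particular there is $q>0$, independent of $y_0$, such that $E^{\theta_*}_{y_0}[T_B]=O\bigl((\log(1/\Delta))^{q}\bigr)$ as $\Delta\downarrow0$ for every $y_0$. -/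

import Mathlib

open MeasureTheory ProbabilityTheory Filter Topology
open scoped ENNReal

namespace Perpetuity

noncomputable section

/-- The data of a Markov-modulated perpetuity: a Markov chain with transition matrix `K` on the
finite set `S`, the common law `ν` of the i.i.d. pairs `(ξₙ, ηₙ)` (independent of the chain; the
two coordinates of a pair may be dependent), the discount rates `γ(x, ξ)` and the non-negative
reward rates `lam(x, η)`. -/
structure Model (S : Type*) [Fintype S] [DecidableEq S] where
  K : Matrix S S ℝ
  K_stochastic : K ∈ Matrix.rowStochastic ℝ S
  ν : Measure (ℝ × ℝ)
  prob_ν : IsProbabilityMeasure ν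
  γ : S → ℝ → ℝ
  measurable_γ : ∀ x, Measurable (γ x)
  lam : S → ℝ → ℝ
  measurable_lam : ∀ x, Measurable (lam x)
  lam_nonneg : ∀ x w, 0 ≤ lam x w

namespace Model

variable {S : Type*} [Fintype S] [DecidableEq S] (M : Model S)

/-- `χ(x, θ) = log E exp(θ γ(x, ξ))`. -/
def chi (x : S) (θ : ℝ) : ℝ := cgf (fun w : ℝ × ℝ => M.γ x w.1) M.ν θ

/-- The matrix `Q_θ(x, y) = K(x, y) exp(χ(y, θ))`. -/
def Q (θ : ℝ) : Matrix S S ℝ := Matrix.of fun x y => M.K x y * Real.exp (M.chi y θ)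

/-- All the moment generating functions `E exp(θ γ(x, ξ))` are finite at `θ`. -/
def MgfFinite (θ : ℝ) : Prop :=
  ∀ x, Integrable (fun w : ℝ × ℝ => Real.exp (θ * M.γ x w.1)) M.ν

open Classical in
/-- `ψ(θ)`: the logarithm of the Perron-Frobenius eigenvalue (the spectral radius) of `Q_θ`,
and `⊤` if some entry of `Q_θ` is infinite (every column of an irreducible stochastic matrix has
a positive entry). -/
def psi (θ : ℝ) : EReal :=
  if M.MgfFinite θ then ENNReal.log (spectralRadius ℂ ((M.Q θ).map (algebraMap ℝ ℂ))) else ⊤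

/-- `v` is a Perron-Frobenius eigenvector at `θ`: it is strictly positive and
`Q_θ v = exp(ψ(θ)) v`. -/
def IsPerronVector (θ : ℝ) (v : S → ℝ) : Prop :=
  (∀ x, 0 < v x) ∧ Matrix.mulVec (M.Q θ) v = Real.exp (M.psi θ).toReal • v

/-- Assumption 1: the chain is irreducible, and `sup_{x, θ ∈ N} E exp(θ γ(x, ξ)) < ∞` for some
neighborhood `N` of the origin. -/
def Assumption1 : Prop :=
  M.K.IsIrreducible ∧
    ∃ N ∈ 𝓝 (0 : ℝ),
      (⨆ x, ⨆ θ ∈ N, ∫⁻ w, ENNReal.ofReal (Real.exp (θ * M.γ x w.1)) ∂M.ν) < ⊤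

/-- Assumption 2 (Cramér's condition) with root `θs`. -/
def Assumption2 (θs : ℝ) : Prop :=
  0 < θs ∧ M.psi θs = 0 ∧ ∃ θ, θs < θ ∧ M.psi θ < ⊤

/-- Assumption 3: `sup_x E_x lam(X₁, η₁)^α < ∞` for each `α ∈ (0, ∞)`. -/
def Assumption3 : Prop :=
  ∀ α : ℝ, 0 < α →
    (⨆ x, ∑ y, ENNReal.ofReal (M.K x y) *
      ∫⁻ w, ENNReal.ofReal (M.lam y w.2 ^ α) ∂M.ν) < ⊤

/-- Assumption 4: `Var γ(x, ξ) > 0` for each `x`. -/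
def Assumption4 : Prop :=
  ∀ x, 0 < variance (fun w : ℝ × ℝ => M.γ x w.1) M.ν

/-- The reward rate does not vanish identically: `P(lam(x, η) > 0) > 0` for some state `x`. -/
def RewardNontrivial : Prop := ∃ x, 0 < M.ν {w | 0 < M.lam x w.2}

/-- The tilted transition matrix `K_θ(x, y) = K(x, y) exp(χ(y, θ) - ψ(θ)) u(y) / u(x)`. -/
def tiltedK (θ : ℝ) (u : S → ℝ) (x y : S) : ℝ :=
  M.K x y * Real.exp (M.chi y θ - (M.psi θ).toReal) * u y / u x

/-- One step of `Yₙ = (Xₙ, Zₙ)`: given `Xₙ₊₁ = y` and `w = (ξₙ₊₁, ηₙ₊₁)`,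
`Yₙ₊₁ = (y, Zₙ exp(-γ(y, ξₙ₊₁)) - Δ lam(y, ηₙ₊₁))`. -/
def move (Δ : ℝ) (y : S) (z : ℝ) (w : ℝ × ℝ) : S × ℝ :=
  (y, z * Real.exp (-M.γ y w.1) - Δ * M.lam y w.2)

variable [MeasurableSpace S]

/-- The law of `Yₙ₊₁` given `Yₙ = (x, z)` under the nominal dynamics. -/
def nominalStep (Δ : ℝ) (x : S) (z : ℝ) : Measure (S × ℝ) :=
  ∑ y, ENNReal.ofReal (M.K x y) • M.ν.map (M.move Δ y z)

/-- The law of `Yₙ₊₁` given `Yₙ = (x, z)` under exponential tilting with parameter `θ`: the next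
state `y` is drawn from `K_θ(x, ·)`; then `γ(y, ξ)` is drawn from its law tilted by
`exp(θ γ(y, ξ) - χ(y, θ))`, and `η` from its nominal conditional law, i.e. `(ξ, η)` is drawn from
`ν` tilted by `exp(θ γ(y, ξ) - χ(y, θ))`. -/
def tiltedStep (θ : ℝ) (u : S → ℝ) (Δ : ℝ) (x : S) (z : ℝ) : Measure (S × ℝ) :=
  ∑ y, ENNReal.ofReal (M.tiltedK θ u x y) •
    (M.ν.tilted fun w => θ * M.γ y w.1).map (M.move Δ y z)

end Model

/-- `ρ_Δ = 1 / log(1/Δ)`. -/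
def rho (Δ : ℝ) : ℝ := 1 / Real.log (1 / Δ)

/-- `c_Δ = (B₂ / B₁) ρ_Δ^{-(1 + 1/(2θs - ρ_Δ))}`. -/
def cDelta (θs B₁ B₂ Δ : ℝ) : ℝ :=
  B₂ / B₁ * rho Δ ^ (-(1 + 1 / (2 * θs - rho Δ)))

/-- The boundary between the regions `C` and `C'` at the state `x`:
`c_Δ Δ u_{θs}(x)^{1/(2θs - ρ_Δ)} u_{θs - ρ_Δ}(x)^{1/(2θs - ρ_Δ)}`. -/
def threshold {S : Type*} (θs : ℝ) (u : ℝ → S → ℝ) (B₁ B₂ Δ : ℝ) (x : S) : ℝ :=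
  cDelta θs B₁ B₂ Δ * Δ * u θs x ^ (1 / (2 * θs - rho Δ)) *
    u (θs - rho Δ) x ^ (1 / (2 * θs - rho Δ))

/-- The region `C`, where exponential tilting is applied. -/
def regionC {S : Type*} (θs : ℝ) (u : ℝ → S → ℝ) (B₁ B₂ Δ : ℝ) : Set (S × ℝ) :=
  {p | threshold θs u B₁ B₂ Δ p.1 < p.2}

lemma measurableSet_regionC {S : Type*} [Fintype S] [MeasurableSpace S]
    [MeasurableSingletonClass S] (θs : ℝ) (u : ℝ → S → ℝ) (B₁ B₂ Δ : ℝ) :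
    MeasurableSet (regionC θs u B₁ B₂ Δ) :=
  measurableSet_lt
    ((measurable_of_countable (threshold θs u B₁ B₂ Δ)).comp measurable_fst) measurable_snd

/-- The law on path space of the time-homogeneous Markov chain with transition kernel `κ` started
at `e`. -/
def chainLaw {E : Type*} [MeasurableSpace E] (κ : Kernel E E) (hκ : IsMarkovKernel κ) (e : E) :
    Measure (ℕ → E) :=
  have : IsMarkovKernel κ := hκ
  Kernel.trajMeasure (X := fun _ => E) (Measure.dirac e) fun n =>
    κ.comap (fun h : (i : Finset.Iic n) → E => h ⟨n, Finset.mem_Iic.2 le_rfl⟩)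
      (measurable_pi_apply _)

namespace Model

variable {S : Type*} [Fintype S] [DecidableEq S] (M : Model S)

lemma measurable_move [MeasurableSpace S] (Δ : ℝ) (y : S) :
    Measurable fun p : ℝ × (ℝ × ℝ) => M.move Δ y p.1 p.2 := by
  have h1 := M.measurable_γ y
  have h2 := M.measurable_lam y
  unfold move
  fun_prop

lemma measurable_move_law [MeasurableSpace S] (Δ : ℝ) (y : S) (μ : Measure (ℝ × ℝ))
    [SFinite μ] : Measurable fun z : ℝ => μ.map (M.move Δ y z) := by
  refine Measure.measurable_of_measurable_coe _ fun A hA => ?_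
  have h := measurable_measure_prodMk_left (ν := μ) (M.measurable_move Δ y hA)
  have heq : (fun z : ℝ => μ.map (M.move Δ y z) A) =
      fun z => μ (Prod.mk z ⁻¹' ((fun p : ℝ × (ℝ × ℝ) => M.move Δ y p.1 p.2) ⁻¹' A)) := by
    funext z
    exact Measure.map_apply ((M.measurable_move Δ y).comp measurable_prodMk_left) hA
  rw [heq]
  exact h

instance [MeasurableSpace S] : IsProbabilityMeasure M.ν := M.prob_ν

variable [MeasurableSpace S] [MeasurableSingletonClass S]

lemma measurable_nominalStep (Δ : ℝ) :
    Measurable fun p : S × ℝ => M.nominalStep Δ p.1 p.2 := by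
  refine measurable_from_prod_countable_right fun x => ?_
  refine Measure.measurable_of_measurable_coe _ fun A hA => ?_
  simp only [nominalStep, Measure.finsetSum_apply, Measure.smul_apply, smul_eq_mul]
  exact Finset.measurable_sum _ fun y _ => Measurable.const_mul
    ((Measure.measurable_coe hA).comp (M.measurable_move_law Δ y M.ν)) _

lemma measurable_tiltedStep (θ : ℝ) (u : S → ℝ) (Δ : ℝ) :
    Measurable fun p : S × ℝ => M.tiltedStep θ u Δ p.1 p.2 := by
  refine measurable_from_prod_countable_right fun x => ?_
  refine Measure.measurable_of_measurable_coe _ fun A hA => ?_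
  simp only [tiltedStep, Measure.finsetSum_apply, Measure.smul_apply, smul_eq_mul]
  exact Finset.measurable_sum _ fun y _ => Measurable.const_mul
    ((Measure.measurable_coe hA).comp (M.measurable_move_law Δ y _)) _

open Classical in
/-- The transition kernel of the state-dependent sampler for `Yₙ = (Xₙ, Zₙ)`: exponential tilting
with parameter `θs` in the region `C`, nominal dynamics elsewhere. (What happens after the set
`B = {z ≤ 0}` has been reached is irrelevant for the termination time.) -/
def samplerKernel (θs : ℝ) (u : ℝ → S → ℝ) (B₁ B₂ Δ : ℝ) : Kernel (S × ℝ) (S × ℝ) where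
  toFun p := if p ∈ regionC θs u B₁ B₂ Δ then M.tiltedStep θs (u θs) Δ p.1 p.2
    else M.nominalStep Δ p.1 p.2
  measurable' := Measurable.ite (measurableSet_regionC θs u B₁ B₂ Δ)
    (M.measurable_tiltedStep θs (u θs) Δ) (M.measurable_nominalStep Δ)

lemma isMarkovKernel_samplerKernel {θs : ℝ} {u : ℝ → S → ℝ} (hψ : M.psi θs = 0)
    (hu : M.IsPerronVector θs (u θs)) (B₁ B₂ Δ : ℝ) :
    IsMarkovKernel (M.samplerKernel θs u B₁ B₂ Δ) := by
  have hfin : M.MgfFinite θs := by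
    by_contra h
    simp [psi, h] at hψ
  have hmove : ∀ (y : S) (z : ℝ), Measurable (M.move Δ y z) := fun y z =>
    (M.measurable_move Δ y).comp measurable_prodMk_left
  refine ⟨fun p => ?_⟩
  obtain ⟨x, z⟩ := p
  rw [samplerKernel, Kernel.coe_mk]
  split_ifs
  · refine ⟨?_⟩
    have hmap : ∀ y : S,
        ((M.ν.tilted fun w => θs * M.γ y w.1).map (M.move Δ y z)) Set.univ = 1 := fun y => by
      have := isProbabilityMeasure_tilted (hfin y)
      rw [Measure.map_apply (hmove y z) MeasurableSet.univ]
      simp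
    have hrow := congrFun hu.2 x
    have hpos := hu.1 x
    simp only [Matrix.mulVec, dotProduct, Q, Matrix.of_apply, Pi.smul_apply, smul_eq_mul, hψ,
      EReal.toReal_zero, Real.exp_zero, one_mul] at hrow
    simp only [tiltedStep, Measure.finsetSum_apply, Measure.smul_apply, smul_eq_mul, hmap,
      mul_one]
    rw [← ENNReal.ofReal_sum_of_nonneg]
    · simp only [tiltedK, hψ, EReal.toReal_zero, sub_zero]
      rw [← Finset.sum_div, hrow, div_self hpos.ne', ENNReal.ofReal_one]
    · intro y _
      exact div_nonneg (mul_nonneg (mul_nonneg (M.K_stochastic.1 x y) (Real.exp_pos _).le)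
        (hu.1 y).le) hpos.le
  · refine ⟨?_⟩
    have hmap : ∀ y : S, (M.ν.map (M.move Δ y z)) Set.univ = 1 := fun y => by
      rw [Measure.map_apply (hmove y z) MeasurableSet.univ]
      simp
    have hrow := congrFun M.K_stochastic.2 x
    simp only [Matrix.mulVec, dotProduct, Pi.one_apply, mul_one] at hrow
    simp only [nominalStep, Measure.finsetSum_apply, Measure.smul_apply, smul_eq_mul, hmap,
      mul_one]
    rw [← ENNReal.ofReal_sum_of_nonneg fun y _ => M.K_stochastic.1 x y, hrow,
      ENNReal.ofReal_one]

/-- `P_y^{θs}`: the law of the state-dependent sampler `(Yₙ)` with parameter `Δ` started at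
`Y₀ = y`. -/
def samplerLaw {θs : ℝ} {u : ℝ → S → ℝ} (hψ : M.psi θs = 0)
    (hu : M.IsPerronVector θs (u θs)) (B₁ B₂ Δ : ℝ) (y : S × ℝ) : Measure (ℕ → S × ℝ) :=
  chainLaw (M.samplerKernel θs u B₁ B₂ Δ) (M.isMarkovKernel_samplerKernel hψ hu B₁ B₂ Δ) y

end Model

/-- The termination time `T_B = inf {n > 0 : Zₙ ≤ 0}` (equal to `⊤` if there is no such `n`). -/
def terminationTime {S : Type*} (Y : ℕ → S × ℝ) : ℕ∞ :=
  ⨅ (n : ℕ) (_ : 0 < n ∧ (Y n).2 ≤ 0), (n : ℕ∞)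

end

end Perpetuity

/-! Everything rests on the Lyapunov function `W(x, z) = z₊ ^ s * h x` with `h = u_{θs} ^ (-s / θs)`
and `s > 0` small.

Under the tilted dynamics the mean of `W` shrinks by a factor `ζ < 1`: the factor `u_{θs}` of the
tilted kernel turns `h` into the power `t = 1 - s / θs` of the Perron vector, strict Jensen for the
noise (nondegenerate variance) and Jensen for the rows of `K` follow, and the Perron equation with
`ψ(θs) = 0` closes the estimate (`exists_tilted_drift`). Rewards only lower `z`, so they can be
dropped here. By concavity, `log (1 + W / β ^ s)` with `β = c Δ` then has drift at most `-k` above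
the threshold, and bounded upward drift below it (`exists_drift`).

It remains to bound the time spent at heights of order `c Δ`. A variable is at most its mean with
positive probability, so each step divides `W` by `1 / ζ` with a probability bounded below; this
holds for the nominal law too, the two laws being equivalent. After `O(log c)` such steps `z` is of
order `Δ`, and irreducibility leads to a state whose reward ends the run. Hence termination occurs
within `O(log c)` steps with probability at least `c ^ (-p)` (`exists_death_below`).

Adding a multiple of the truncated expected lifetime to the logarithmic function gives a drift of
`-k` everywhere (`tsum_alive_le_of_drift`), and so a mean of order `c ^ p log c + log (1 + z₊ / (c
Δ))`. As `c_Δ` is at most a power of `log (1/Δ)`, the polylogarithmic bound follows. -/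

namespace Perpetuity

/-! ### Expected lifetime of a killed Markov chain from drift conditions -/

section KilledChain

variable {E : Type*} [MeasurableSpace E]

lemma lintegral_eval_zero_chainLaw (κ : Kernel E E) (hκ : IsMarkovKernel κ) (e : E)
    {f : E → ℝ≥0∞} (hf : Measurable f) :
    ∫⁻ Y, f (Y 0) ∂chainLaw κ hκ e = f e := by
  have h0 : Measurable fun h : (i : Finset.Iic 0) → E => h ⟨0, Finset.mem_Iic.2 le_rfl⟩ :=
    measurable_pi_apply _
  have h1 : (fun Y : ℕ → E => f (Y 0)) = fun Y => (fun h : (i : Finset.Iic 0) → E =>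
      f (h ⟨0, Finset.mem_Iic.2 le_rfl⟩)) (Preorder.frestrictLe (π := fun _ => E) 0 Y) := rfl
  have h2 := lintegral_map (μ := chainLaw κ hκ e) (hf.comp h0)
    (Preorder.measurable_frestrictLe (X := fun _ => E) 0)
  rw [h1]
  refine h2.symm.trans ?_
  rw [chainLaw, Kernel.trajMeasure,
    Measure.map_comp _ _ (by fun_prop), Kernel.traj_map_frestrictLe, Kernel.partialTraj_self,
    Measure.id_comp, lintegral_map (hf.comp h0) (by fun_prop), lintegral_dirac' _ (by fun_prop)]
  rfl

/-- The Markov property at a deterministic time. -/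
lemma lintegral_markov_chainLaw (κ : Kernel E E) (hκ : IsMarkovKernel κ) (e : E) (n : ℕ)
    {g : ((i : Finset.Iic n) → E) → ℝ≥0∞} (hg : Measurable g)
    {f : E → ℝ≥0∞} (hf : Measurable f) :
    ∫⁻ Y, g (Preorder.frestrictLe (π := fun _ => E) n Y) * f (Y (n + 1)) ∂chainLaw κ hκ e =
      ∫⁻ Y, g (Preorder.frestrictLe (π := fun _ => E) n Y) * ∫⁻ q, f q ∂κ (Y n)
        ∂chainLaw κ hκ e := by
  have hF : Measurable fun p : ((i : Finset.Iic n) → E) × E => g p.1 * f p.2 := by fun_prop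
  have hm : Measurable fun Y : ℕ → E =>
      (Preorder.frestrictLe (π := fun _ => E) n Y, Y (n + 1)) := by fun_prop
  have hK : Measurable fun x => ∫⁻ q, f q ∂κ x := hf.lintegral_kernel
  have hr : Measurable fun h : (i : Finset.Iic n) → E => h ⟨n, Finset.mem_Iic.2 le_rfl⟩ :=
    measurable_pi_apply _
  have key := Kernel.map_frestrictLe_trajMeasure_compProd_eq_map_trajMeasure
    (X := fun _ => E) (μ₀ := Measure.dirac e) (κ := fun n =>
    κ.comap (fun h : (i : Finset.Iic n) → E => h ⟨n, Finset.mem_Iic.2 le_rfl⟩)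
      (measurable_pi_apply _)) (a := n)
  have h2 := lintegral_map (μ := chainLaw κ hκ e) hF hm
  rw [← h2]
  change ∫⁻ a, _ ∂(Measure.map _ (Kernel.trajMeasure _ _)) = _
  rw [← key, Measure.lintegral_compProd hF, lintegral_map (by fun_prop) (by fun_prop)]
  refine lintegral_congr fun Y => ?_
  simp only [Kernel.comap_apply]
  rw [lintegral_const_mul _ hf]
  rfl

/-- A drift condition for the chain killed outside `A` bounds the expected killing time. -/
lemma tsum_alive_le (κ : Kernel E E) (hκ : IsMarkovKernel κ) (e : E) {A : Set E}
    (hA : MeasurableSet A) {V : E → ℝ≥0∞} (hV : Measurable V)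
    (hdrift : ∀ p, ∫⁻ q in A, V q ∂κ p + 1 ≤ V p) :
    ∑' n, chainLaw κ hκ e {Y | ∀ k, 0 < k → k ≤ n → Y k ∈ A} ≤ V e := by
  set μ := chainLaw κ hκ e
  let B : (n : ℕ) → Set (ℕ → E) := fun n => {Y | ∀ k, 0 < k → k ≤ n → Y k ∈ A}
  have hB : ∀ n, MeasurableSet (B n) := fun n => by
    simp only [B, Set.ofPred_forall]
    exact .iInter fun k => .iInter fun _ => .iInter fun _ => measurable_pi_apply k hA
  -- The mean of `V (Y n)` on survival up to time `n`. The drift makes it fall by at least `μ (B n)`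
  -- at each step, and the sum telescopes.
  let a : ℕ → ℝ≥0∞ := fun n => ∫⁻ Y, (B n).indicator 1 Y * V (Y n) ∂μ
  have hstep : ∀ n, a (n + 1) + μ (B n) ≤ a n := fun n => by
    let g : ((i : Finset.Iic n) → E) → ℝ≥0∞ :=
      Set.indicator {h | ∀ k : Finset.Iic n, 0 < k.1 → h k ∈ A} 1
    have hg : Measurable g := by
      refine measurable_one.indicator ?_
      simp only [Set.ofPred_forall]
      exact .iInter fun k => .iInter fun _ => measurable_pi_apply k hA
    have hgB : ∀ Y, (B n).indicator (1 : (ℕ → E) → ℝ≥0∞) Y =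
        g (Preorder.frestrictLe (π := fun _ => E) n Y) := fun Y => by
      have : Y ∈ B n ↔ Preorder.frestrictLe (π := fun _ => E) n Y ∈
          {h : (i : Finset.Iic n) → E | ∀ k : Finset.Iic n, 0 < k.1 → h k ∈ A} :=
        ⟨fun h k hk => h k.1 hk (Finset.mem_Iic.1 k.2),
          fun h k hk hkn => h ⟨k, Finset.mem_Iic.2 hkn⟩ hk⟩
      simp only [g]
      by_cases h : Y ∈ B n
      · rw [Set.indicator_of_mem h, Set.indicator_of_mem (this.1 h)]
        rfl
      · rw [Set.indicator_of_notMem h, Set.indicator_of_notMem fun h' => h (this.2 h')]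
    have h1 : a (n + 1) = ∫⁻ Y, g (Preorder.frestrictLe (π := fun _ => E) n Y) *
        ∫⁻ q in A, V q ∂κ (Y n) ∂μ := by
      have := lintegral_markov_chainLaw κ hκ e n hg (hV.indicator hA)
      simp only [lintegral_indicator hA] at this
      rw [← this]
      refine lintegral_congr fun Y => ?_
      rw [← hgB]
      have h3 : Y ∈ B (n + 1) ↔ Y ∈ B n ∧ Y (n + 1) ∈ A :=
        ⟨fun h => ⟨fun k hk hkn => h k hk (by omega), h _ (by omega) le_rfl⟩,
          fun h k hk hkn => by
            rcases Nat.lt_or_ge n k with h4 | h4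
            · obtain rfl : k = n + 1 := by omega
              exact h.2
            · exact h.1 k hk h4⟩
      by_cases h4 : Y ∈ B n <;> by_cases h5 : Y (n + 1) ∈ A <;>
        simp [h3, h4, h5]
    have h2 : μ (B n) = ∫⁻ Y, g (Preorder.frestrictLe (π := fun _ => E) n Y) ∂μ := by
      rw [← lintegral_indicator_one (hB n)]
      exact lintegral_congr fun Y => hgB Y
    rw [h1, h2, ← lintegral_add_right _ (by fun_prop)]
    refine lintegral_mono fun Y => ?_
    simp only
    rw [hgB, ← mul_add_one]
    exact mul_le_mul_right (hdrift _) _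
  have hsum : ∀ n, ∑ j ∈ Finset.range n, μ (B j) + a n ≤ a 0 := fun n => by
    induction n with
    | zero => simp
    | succ n ih =>
      rw [Finset.sum_range_succ, add_assoc, add_comm (μ (B n))]
      exact (add_le_add le_rfl (hstep n)).trans ih
  have ha0 : a 0 = V e := by
    rw [← lintegral_eval_zero_chainLaw κ hκ e hV]
    refine lintegral_congr fun Y => ?_
    -- Time `0` is exempt from the survival requirement, so the starting point need not lie in `A`.
    have : Y ∈ B 0 := fun k hk hk0 => by omega
    simp [this]
  rw [← ha0, ENNReal.tsum_eq_iSup_nat]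
  exact iSup_le fun n => le_self_add.trans (hsum n)

/-- The probability that the chain with kernel `κ`, killed outside `A`, survives `n` steps. -/
noncomputable def survival (κ : Kernel E E) (A : Set E) : ℕ → E → ℝ≥0∞
  | 0 => 1
  | n + 1 => fun p => ∫⁻ q in A, survival κ A n q ∂κ p

lemma measurable_setLIntegral_kernel (κ : Kernel E E) {A : Set E} (hA : MeasurableSet A)
    {f : E → ℝ≥0∞} (hf : Measurable f) : Measurable fun p => ∫⁻ q in A, f q ∂κ p := by
  simp only [← lintegral_indicator hA]
  exact (hf.indicator hA).lintegral_kernel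

lemma measurable_survival (κ : Kernel E E) {A : Set E} (hA : MeasurableSet A) (n : ℕ) :
    Measurable (survival κ A n) := by
  induction n with
  | zero => exact measurable_one
  | succ n ih => exact measurable_setLIntegral_kernel κ hA ih

lemma survival_le_one (κ : Kernel E E) [IsMarkovKernel κ] (A : Set E) (n : ℕ) (p : E) :
    survival κ A n p ≤ 1 := by
  induction n generalizing p with
  | zero => exact le_rfl
  | succ n ih =>
    calc survival κ A (n + 1) p ≤ ∫⁻ _ in A, 1 ∂κ p := lintegral_mono fun q => ih q
      _ ≤ 1 := by simpa using prob_le_one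

lemma survival_succ_le (κ : Kernel E E) [IsMarkovKernel κ] (A : Set E) (n : ℕ) (p : E) :
    survival κ A (n + 1) p ≤ survival κ A n p := by
  induction n generalizing p with
  | zero => exact survival_le_one κ A 1 p
  | succ n ih => exact lintegral_mono fun q => ih q

lemma survival_antitone (κ : Kernel E E) [IsMarkovKernel κ] (A : Set E) (p : E) :
    Antitone fun n => survival κ A n p :=
  antitone_nat_of_succ_le fun n => survival_succ_le κ A n p

/-- If with probability at least `ε` the first step leads to death or to a point from which death
within `n` steps has probability at least `d`, then death within `n + 1` steps has probability at
least `ε d`. -/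
lemma survival_succ_add_le (κ : Kernel E E) [IsMarkovKernel κ] {A B : Set E}
    (hA : MeasurableSet A) (hB : MeasurableSet B) {n : ℕ} {d ε : ℝ≥0∞} (hd : d ≤ 1)
    (h : ∀ q ∈ A ∩ B, survival κ A n q + d ≤ 1) {p : E} (hp : ε ≤ κ p B) :
    survival κ A (n + 1) p + ε * d ≤ 1 := by
  have hm : Measurable (A.indicator (survival κ A n)) :=
    (measurable_survival κ hA n).indicator hA
  calc survival κ A (n + 1) p + ε * d
      ≤ ∫⁻ q, A.indicator (survival κ A n) q ∂κ p + d * κ p B := by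
        rw [survival, lintegral_indicator hA, mul_comm]
        gcongr
    _ = ∫⁻ q, A.indicator (survival κ A n) q + B.indicator (fun _ => d) q ∂κ p := by
        rw [lintegral_add_left hm, lintegral_indicator_const hB]
    _ ≤ ∫⁻ _, 1 ∂κ p := by
        refine lintegral_mono fun q => ?_
        by_cases h1 : q ∈ A <;> by_cases h2 : q ∈ B
        · simpa [h1, h2] using h q ⟨h1, h2⟩
        · simpa [h1, h2] using survival_le_one κ A n q
        · simpa [h1, h2] using hd
        · simp [h1, h2]
    _ = 1 := by simp

/-- A function with a uniform negative drift off `D` together with a uniform chance of being killed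
within `N` steps on `D` bounds the expected killing time. -/
lemma tsum_alive_le_of_drift (κ : Kernel E E) (hκ : IsMarkovKernel κ) (e : E) {A D : Set E}
    (hA : MeasurableSet A) {U : E → ℝ≥0∞} (hU : Measurable U) {k c δ : ℝ≥0∞}
    (hk0 : k ≠ 0) (hk : k ≠ ⊤) (hδ0 : δ ≠ 0) (N : ℕ)
    (hdrift : ∀ p, ∫⁻ q in A, U q ∂κ p + k ≤ U p + D.indicator (fun _ => c) p)
    (hD : ∀ p ∈ D, survival κ A N p + δ ≤ 1) :
    ∑' n, chainLaw κ hκ e {Y | ∀ k, 0 < k → k ≤ n → Y k ∈ A} ≤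
      k⁻¹ * (U e + c / δ * N) := by
  -- A point of `D` is what forces `δ ≤ 1`, hence `δ` finite; if `D` is empty the drift of `U` alone
  -- suffices.
  by_cases hDe : D.Nonempty
  swap
  · have hD0 : D = ∅ := Set.not_nonempty_iff_eq_empty.1 hDe
    refine (tsum_alive_le κ hκ e hA (hU.const_mul k⁻¹) fun p => ?_).trans
      (mul_le_mul_right le_self_add _)
    rw [lintegral_const_mul _ hU, ← ENNReal.inv_mul_cancel hk0 hk, ← mul_add]
    simpa [hD0] using mul_le_mul_right (hdrift p) k⁻¹
  obtain ⟨p0, hp0⟩ := hDe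
  have hδ : δ ≠ ⊤ := ne_top_of_le_ne_top ENNReal.one_ne_top (le_add_self.trans (hD p0 hp0))
  -- Expected lifetime truncated at `N`. One killed step lowers it by exactly `1 - survival κ A N
  -- p`, which is at least `δ` on `D`, so `c / δ * G` compensates the excess `c` there at a cost of
  -- at most `c / δ * N`.
  let G : E → ℝ≥0∞ := fun p => ∑ j ∈ Finset.range N, survival κ A j p
  have hGm : Measurable G := Finset.measurable_sum _ fun j _ => measurable_survival κ hA j
  have hGle : ∀ p, G p ≤ N := fun p => by
    simpa using Finset.sum_le_sum fun j (_ : j ∈ Finset.range N) => survival_le_one κ A j p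
  have hG : ∀ p, ∫⁻ q in A, G q ∂κ p + D.indicator (fun _ => δ) p ≤ G p := fun p => by
    have h1 : ∫⁻ q in A, G q ∂κ p + 1 = G p + survival κ A N p := by
      simp only [G]
      rw [lintegral_finsetSum _ fun j _ => measurable_survival κ hA j,
        ← Finset.sum_range_succ, Finset.sum_range_succ']
      rfl
    have h2 : survival κ A N p + D.indicator (fun _ => δ) p ≤ 1 := by
      by_cases h : p ∈ D
      · simpa [h] using hD p h
      · simpa [h] using survival_le_one κ A N p
    refine (ENNReal.add_le_add_iff_right (a := survival κ A N p)
      (ne_top_of_le_ne_top ENNReal.one_ne_top (survival_le_one κ A N p))).1 ?_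
    rw [← h1, add_assoc, add_comm (D.indicator _ p)]
    exact add_le_add le_rfl h2
  have hfin := tsum_alive_le κ hκ e hA (V := fun p => k⁻¹ * (U p + c / δ * G p))
    (by fun_prop) fun p => ?_
  · exact hfin.trans (by gcongr; exact hGle e)
  · rw [lintegral_const_mul _ (by fun_prop), lintegral_add_left hU, lintegral_const_mul _ hGm,
      ← ENNReal.inv_mul_cancel hk0 hk, ← mul_add]
    refine mul_le_mul_right ?_ _
    have h3 : D.indicator (fun _ => c) p = c / δ * D.indicator (fun _ => δ) p := by
      by_cases h : p ∈ D
      · simp [h, ENNReal.div_mul_cancel hδ0 hδ]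
      · simp [h]
    calc ∫⁻ q in A, U q ∂κ p + c / δ * ∫⁻ q in A, G q ∂κ p + k
        = (∫⁻ q in A, U q ∂κ p + k) + c / δ * ∫⁻ q in A, G q ∂κ p := by ring
      _ ≤ (U p + c / δ * D.indicator (fun _ => δ) p) + c / δ * ∫⁻ q in A, G q ∂κ p := by
        rw [← h3]
        exact add_le_add (hdrift p) le_rfl
      _ = U p + c / δ * (∫⁻ q in A, G q ∂κ p + D.indicator (fun _ => δ) p) := by ring
      _ ≤ _ := by gcongr; exact hG p

end KilledChain

/-! ### The termination time as a sum of survival probabilities -/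

section TerminationTime

variable {S : Type*}

lemma lt_terminationTime_iff (Y : ℕ → S × ℝ) (n : ℕ) :
    (n : ℕ∞) < terminationTime Y ↔ ∀ k, 0 < k → k ≤ n → Y k ∈ {q : S × ℝ | 0 < q.2} := by
  constructor
  · intro h k hk hkn
    by_contra h2
    have h3 : terminationTime Y ≤ k := iInf₂_le k ⟨hk, not_lt.1 h2⟩
    exact absurd (h.trans_le h3) (not_lt.2 (by exact_mod_cast hkn))
  · intro h
    have h1 : ((n + 1 : ℕ) : ℕ∞) ≤ terminationTime Y := by
      refine le_iInf₂ fun k hk => ?_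
      by_contra h2
      have h3 : k < n + 1 := by exact_mod_cast not_le.1 h2
      exact absurd (h k hk.1 (by omega)) (not_lt.2 hk.2)
    exact lt_of_lt_of_le (by exact_mod_cast Nat.lt_succ_self n) h1

lemma coe_eq_tsum_indicator (T : ℕ∞) :
    (T : ℝ≥0∞) = ∑' n : ℕ, if (n : ℕ∞) < T then 1 else 0 := by
  induction T using ENat.recTopCoe with
  | top => simp
  | coe m =>
    rw [tsum_eq_sum (s := Finset.range m) (fun n hn => by simpa using hn),
      Finset.sum_congr rfl (g := fun _ => 1) fun n hn => by simpa using hn]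
    simp

/-- The tail-sum formula, in the form that meets the killed-chain bounds; measurability is recorded
for the almost sure finiteness. -/
lemma lintegral_terminationTime [MeasurableSpace S] (μ : Measure (ℕ → S × ℝ)) :
    AEMeasurable (fun Y => (terminationTime Y : ℝ≥0∞)) μ ∧
    ∫⁻ Y, (terminationTime Y : ℝ≥0∞) ∂μ =
      ∑' n, μ {Y | ∀ k, 0 < k → k ≤ n → Y k ∈ {q : S × ℝ | 0 < q.2}} := by
  have hB : ∀ n : ℕ, MeasurableSet
      {Y : ℕ → S × ℝ | ∀ k, 0 < k → k ≤ n → Y k ∈ {q : S × ℝ | 0 < q.2}} := fun n => by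
    simp only [Set.ofPred_forall]
    exact .iInter fun k => .iInter fun _ => .iInter fun _ =>
      measurable_pi_apply k (measurableSet_lt measurable_const measurable_snd)
  have h : (fun Y : ℕ → S × ℝ => (terminationTime Y : ℝ≥0∞)) = fun Y => ∑' n : ℕ,
      {Y : ℕ → S × ℝ | ∀ k, 0 < k → k ≤ n → Y k ∈ {q : S × ℝ | 0 < q.2}}.indicator 1 Y := by
    funext Y
    rw [coe_eq_tsum_indicator]
    refine tsum_congr fun n => ?_
    have hiff : (n : ℕ∞) < terminationTime Y ↔
      Y ∈ {Y : ℕ → S × ℝ | ∀ k, 0 < k → k ≤ n → Y k ∈ {q : S × ℝ | 0 < q.2}} :=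
      lt_terminationTime_iff Y n
    split_ifs with h
    · rw [Set.indicator_of_mem (hiff.1 h), Pi.one_apply]
    · rw [Set.indicator_of_notMem fun h' => h (hiff.2 h')]
  refine ⟨?_, ?_⟩
  · rw [h]
    exact (Measurable.tsum fun n => measurable_one.indicator (hB n)).aemeasurable
  · rw [h, lintegral_tsum fun n => (measurable_one.indicator (hB n)).aemeasurable]
    exact tsum_congr fun n => lintegral_indicator_one (hB n)

end TerminationTime

end Perpetuity

/-! ### Contraction of the Lyapunov function under tilting -/

namespace Perpetuity

namespace Model

section Drift

variable {S : Type*} [Fintype S] [DecidableEq S] {M : Model S} {θ : ℝ} {v : S → ℝ}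

lemma mgfFinite_of_psi_eq_zero (hψ : M.psi θ = 0) : M.MgfFinite θ := by
  by_contra h
  simp [psi, h] at hψ

lemma sum_K (M : Model S) (x : S) : ∑ y, M.K x y = 1 := by
  have hrow := congrFun M.K_stochastic.2 x
  simpa only [Matrix.mulVec, dotProduct, Pi.one_apply, mul_one] using hrow

lemma K_nonneg (M : Model S) (x y : S) : 0 ≤ M.K x y := M.K_stochastic.1 x y

/-- The moment generating function of `γ(y, ξ)`. -/
noncomputable def phi (M : Model S) (y : S) (θ : ℝ) : ℝ :=
  mgf (fun w : ℝ × ℝ => M.γ y w.1) M.ν θ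

lemma phi_pos (hfin : M.MgfFinite θ) (y : S) : 0 < M.phi y θ :=
  haveI := M.prob_ν
  mgf_pos (hfin y)

lemma exp_chi (hfin : M.MgfFinite θ) (y : S) : Real.exp (M.chi y θ) = M.phi y θ :=
  haveI := M.prob_ν
  exp_cgf (hfin y)

lemma tiltedK_eq (hψ : M.psi θ = 0) (x y : S) :
    M.tiltedK θ v x y = M.K x y * M.phi y θ * v y / v x := by
  simp [tiltedK, hψ, exp_chi (mgfFinite_of_psi_eq_zero hψ)]

lemma IsPerronVector.sum_eq (hψ : M.psi θ = 0) (hv : M.IsPerronVector θ v) (x : S) :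
    ∑ y, M.K x y * (M.phi y θ * v y) = v x := by
  have hrow := congrFun hv.2 x
  simpa [Matrix.mulVec, dotProduct, Q, Matrix.of_apply, hψ, mul_assoc,
    exp_chi (mgfFinite_of_psi_eq_zero hψ)] using hrow

lemma tiltedK_nonneg (hv : M.IsPerronVector θ v) (x y : S) : 0 ≤ M.tiltedK θ v x y :=
  div_nonneg (mul_nonneg (mul_nonneg (M.K_nonneg x y) (Real.exp_pos _).le) (hv.1 y).le)
    (hv.1 x).le

lemma tiltedK_pos (hv : M.IsPerronVector θ v) {x y : S} (hK : 0 < M.K x y) :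
    0 < M.tiltedK θ v x y :=
  div_pos (mul_pos (mul_pos hK (Real.exp_pos _)) (hv.1 y)) (hv.1 x)

lemma K_pos_of_tiltedK_pos {x y : S} (h : 0 < M.tiltedK θ v x y) : 0 < M.K x y := by
  refine lt_of_le_of_ne (M.K_nonneg x y) fun h0 => ?_
  simp [tiltedK, ← h0] at h

lemma sum_tiltedK (hψ : M.psi θ = 0) (hv : M.IsPerronVector θ v) (x : S) :
    ∑ y, M.tiltedK θ v x y = 1 := by
  simp only [tiltedK_eq hψ, mul_assoc]
  rw [← Finset.sum_div, hv.sum_eq hψ, div_self (hv.1 x).ne']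

/-- Strict logarithmic convexity of the moment generating function, between `0` and `θ`. -/
lemma phi_lt_rpow (h4 : M.Assumption4) (hθ : 0 < θ) (hfin : M.MgfFinite θ) {t : ℝ} (ht0 : 0 < t)
    (ht1 : t < 1) (y : S) : M.phi y (t * θ) < M.phi y θ ^ t := by
  have := M.prob_ν
  have hrw : ∀ w : ℝ × ℝ, Real.exp (θ * M.γ y w.1) ^ t = Real.exp (t * θ * M.γ y w.1) :=
    fun w => by rw [← Real.exp_mul]; ring_nf
  have hint : Integrable (fun w : ℝ × ℝ => Real.exp (t * θ * M.γ y w.1)) M.ν :=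
    integrable_exp_mul_of_nonneg_of_le (hfin y) (by positivity) (by nlinarith)
  rcases (Real.strictConcaveOn_rpow ht0 ht1).ae_eq_const_or_lt_map_average (μ := M.ν)
    (f := fun w : ℝ × ℝ => Real.exp (θ * M.γ y w.1))
    (Real.continuous_rpow_const ht0.le).continuousOn isClosed_Ici
    (ae_of_all _ fun w => (Real.exp_pos _).le) (hfin y) (by simpa [Function.comp_def, hrw]) with
    h | h
  -- Equality in Jensen makes `exp (θ γ)`, hence `γ`, almost surely constant.
  · exfalso
    have hc : (fun w : ℝ × ℝ => M.γ y w.1) =ᵐ[M.ν] fun _ =>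
        Real.log (⨍ x, Real.exp (θ * M.γ y x.1) ∂M.ν) / θ := by
      filter_upwards [h] with w hw
      simp only [Function.const_apply] at hw
      rw [← hw, Real.log_exp, mul_div_cancel_left₀ _ hθ.ne']
    have h0 := h4 y
    rw [variance_congr hc] at h0
    simp [variance_eq_integral] at h0
  · simpa only [phi, mgf, average_eq_integral, hrw] using h

/-- Below the threshold one nominal step multiplies `z ^ s` by up to `exp (-s γ)`, so a small
negative exponential moment is needed. -/
lemma exists_integrable_exp_neg (h1 : M.Assumption1) :
    ∃ r > 0, ∀ s, 0 < s → s < r → M.MgfFinite (-s) := by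
  obtain ⟨-, N, hN, hsup⟩ := h1
  obtain ⟨r, hr, hball⟩ := Metric.mem_nhds_iff.1 hN
  refine ⟨r, hr, fun s hs hsr x => ?_⟩
  have hmem : -s ∈ N := hball (by simpa [abs_of_pos hs] using hsr)
  have hle := (le_iSup₂ (f := fun θ (_ : θ ∈ N) =>
    ∫⁻ w, ENNReal.ofReal (Real.exp (θ * M.γ x w.1)) ∂M.ν) (-s) hmem).trans
    (le_iSup (fun x => ⨆ θ ∈ N, ∫⁻ w, ENNReal.ofReal (Real.exp (θ * M.γ x w.1)) ∂M.ν) x)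
  have hmeas := M.measurable_γ x
  refine ⟨(show Measurable _ by fun_prop).aestronglyMeasurable, ?_⟩
  rw [hasFiniteIntegral_iff_ofReal (ae_of_all _ fun w => (Real.exp_pos _).le)]
  exact hle.trans_lt hsup

lemma integrable_exp_tilted (hfin : M.MgfFinite θ) {s : ℝ} (hs : M.MgfFinite (θ - s)) (y : S) :
    Integrable (fun w : ℝ × ℝ => Real.exp (-s * M.γ y w.1))
      (M.ν.tilted fun w => θ * M.γ y w.1) := by
  rw [integrable_tilted_iff (hfin y)]
  refine (hs y).congr (ae_of_all _ fun w => ?_)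
  simp only [smul_eq_mul]
  rw [← Real.exp_add]
  ring_nf

lemma integral_exp_tilted_eq (y : S) (s : ℝ) :
    ∫ w, Real.exp (-s * M.γ y w.1) ∂(M.ν.tilted fun w => θ * M.γ y w.1) =
      M.phi y (θ - s) / M.phi y θ := by
  rw [integral_exp_tilted]
  simp only [phi, mgf, Pi.add_apply]
  congr 2
  funext w
  ring_nf

/-- Under the tilted dynamics `z ^ s * h x`, with `h = v ^ (-s / θ)`, has a uniform multiplicative
drift towards `0`. -/
lemma exists_tilted_drift (h4 : M.Assumption4) (hθ : 0 < θ) (hψ : M.psi θ = 0)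
    (hv : M.IsPerronVector θ v) {s : ℝ} (hs : 0 < s) (hsθ : s < θ) :
    ∃ ζ, 0 < ζ ∧ ζ < 1 ∧ ∀ x, ∑ y, M.tiltedK θ v x y *
      ((∫ w, Real.exp (-s * M.γ y w.1) ∂(M.ν.tilted fun w => θ * M.γ y w.1)) *
        v y ^ (-s / θ)) ≤ ζ * v x ^ (-s / θ) := by
  have hfin := mgfFinite_of_psi_eq_zero hψ
  set L : S → ℝ := fun x => ∑ y, M.tiltedK θ v x y *
      ((∫ w, Real.exp (-s * M.γ y w.1) ∂(M.ν.tilted fun w => θ * M.γ y w.1)) *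
        v y ^ (-s / θ)) with hL
  have ht0 : 0 < 1 - s / θ := by
    rw [sub_pos, div_lt_one hθ]; exact hsθ
  have ht1 : 1 - s / θ < 1 := by
    have : 0 < s / θ := by positivity
    linarith
  have hst : θ - s = (1 - s / θ) * θ := by field_simp
  have hlt : ∀ x, L x < v x ^ (-s / θ) := fun x => by
    -- The normalization of the tilted noise cancels against the `phi y θ` in the tilted kernel, and
    -- `v * v ^ (-s / θ)` merges into one power.
    have hrw : L x = (∑ y, M.K x y * (M.phi y (θ - s) * v y ^ (1 - s / θ))) / v x := by
      rw [hL, Finset.sum_div]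
      refine Finset.sum_congr rfl fun y _ => ?_
      have hy := (phi_pos hfin y).ne'
      have hx := (hv.1 x).ne'
      rw [integral_exp_tilted_eq, tiltedK_eq hψ, sub_eq_add_neg 1, Real.rpow_add (hv.1 y),
        Real.rpow_one, neg_div]
      field_simp
    have h1 : ∑ y, M.K x y * (M.phi y (θ - s) * v y ^ (1 - s / θ)) <
        ∑ y, M.K x y * (M.phi y θ * v y) ^ (1 - s / θ) := by
      have hy : ∀ y, M.phi y (θ - s) * v y ^ (1 - s / θ) < (M.phi y θ * v y) ^ (1 - s / θ) :=
        fun y => by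
          rw [Real.mul_rpow (phi_pos hfin y).le (hv.1 y).le, hst]
          exact mul_lt_mul_of_pos_right (phi_lt_rpow h4 hθ hfin ht0 ht1 y)
            (Real.rpow_pos_of_pos (hv.1 y) _)
      obtain ⟨y, hyK⟩ : ∃ y, 0 < M.K x y := by
        by_contra! h
        have := M.sum_K x
        rw [Finset.sum_eq_zero fun y _ => le_antisymm (h y) (M.K_nonneg x y)] at this
        exact zero_ne_one this
      exact Finset.sum_lt_sum (fun y _ => mul_le_mul_of_nonneg_left (hy y).le (M.K_nonneg x y))
        ⟨y, Finset.mem_univ y, mul_lt_mul_of_pos_left (hy y) hyK⟩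
    -- Jensen on the row `K x ·`; the Perron equation evaluates the inner average as `v x`.
    have h2 := (Real.concaveOn_rpow ht0.le ht1.le).le_map_sum (t := Finset.univ)
      (w := fun y => M.K x y) (p := fun y => M.phi y θ * v y) (fun y _ => M.K_nonneg x y)
      (M.sum_K x) fun y _ => (mul_pos (phi_pos hfin y) (hv.1 y)).le
    simp only [smul_eq_mul, hv.sum_eq hψ] at h2
    rw [hrw, div_lt_iff₀ (hv.1 x)]
    refine (h1.trans_le h2).trans_eq ?_
    rw [sub_eq_neg_add, Real.rpow_add (hv.1 x), Real.rpow_one, neg_div]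
  have hpos : ∀ x, 0 < v x ^ (-s / θ) := fun x => Real.rpow_pos_of_pos (hv.1 x) _
  -- Finitely many strict inequalities leave room for one `ζ < 1` common to all states.
  have hev : ∀ᶠ ζ : ℝ in 𝓝[<] 1, 0 < ζ ∧ ζ < 1 ∧ ∀ x, L x ≤ ζ * v x ^ (-s / θ) := by
    have h3 : ∀ᶠ ζ : ℝ in 𝓝[<] 1, ∀ x, L x ≤ ζ * v x ^ (-s / θ) := by
      rw [eventually_all]
      intro x
      have h4 : Tendsto (fun ζ : ℝ => ζ * v x ^ (-s / θ)) (𝓝[<] 1) (𝓝 (1 * v x ^ (-s / θ))) :=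
        ((continuous_id.mul continuous_const).tendsto 1).mono_left nhdsWithin_le_nhds
      rw [one_mul] at h4
      exact (h4.eventually (lt_mem_nhds (hlt x))).mono fun ζ h => h.le
    have h5 : ∀ᶠ ζ : ℝ in 𝓝[<] 1, 0 < ζ := nhdsWithin_le_nhds (lt_mem_nhds one_pos)
    filter_upwards [h3, h5, self_mem_nhdsWithin] with ζ a b c using ⟨b, c, a⟩
  exact hev.exists

/-- From every state there is a successor state at which, with positive probability, the Lyapunov
function `z ^ s * h x` decreases by the factor `ζ`. -/
lemma exists_successor_decrease (hψ : M.psi θ = 0) (hv : M.IsPerronVector θ v) {s ζ : ℝ}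
    (hs : M.MgfFinite (θ - s)) {h : S → ℝ} {x : S}
    (hdrift : ∑ y, M.tiltedK θ v x y *
      ((∫ w, Real.exp (-s * M.γ y w.1) ∂(M.ν.tilted fun w => θ * M.γ y w.1)) * h y) ≤ ζ * h x) :
    ∃ y, 0 < M.K x y ∧ M.ν {w | Real.exp (-s * M.γ y w.1) * h y ≤ ζ * h x} ≠ 0 := by
  have hfin := mgfFinite_of_psi_eq_zero hψ
  have := M.prob_ν
  -- An average over successors is at most `ζ h x`, so one reachable successor has conditional mean
  -- at most that.
  obtain ⟨y, hy, hle⟩ : ∃ y, 0 < M.tiltedK θ v x y ∧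
      (∫ w, Real.exp (-s * M.γ y w.1) ∂(M.ν.tilted fun w => θ * M.γ y w.1)) * h y ≤ ζ * h x := by
    by_contra! hcon
    refine absurd hdrift (not_le.2 ?_)
    have hsum := sum_tiltedK hψ hv x
    calc ζ * h x = ∑ y, M.tiltedK θ v x y * (ζ * h x) := by
          rw [← Finset.sum_mul, hsum, one_mul]
      _ < _ := by
        obtain ⟨y, hyK⟩ : ∃ y, 0 < M.tiltedK θ v x y := by
          by_contra! h'
          rw [Finset.sum_eq_zero fun y _ => le_antisymm (h' y) (tiltedK_nonneg hv x y)] at hsum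
          exact zero_ne_one hsum
        refine Finset.sum_lt_sum (fun y _ => ?_)
          ⟨y, Finset.mem_univ y, mul_lt_mul_of_pos_left (hcon y hyK) hyK⟩
        rcases (tiltedK_nonneg hv x y).eq_or_lt with h0 | h0
        · simp [← h0]
        · exact mul_le_mul_of_nonneg_left (hcon y h0).le h0.le
  refine ⟨y, K_pos_of_tiltedK_pos hy, fun h0 => ?_⟩
  have := isProbabilityMeasure_tilted (hfin y)
  -- A variable is at most its mean with positive tilted probability; absolute continuity carries
  -- this over to `ν`.
  have hpos := measure_le_integral_pos ((integrable_exp_tilted hfin hs y).mul_const (h y))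
  refine hpos.ne' (measure_mono_null (fun w hw => ?_) (tilted_absolutelyContinuous M.ν _ h0))
  simp only [Set.mem_ofPred_eq, integral_mul_const] at hw ⊢
  exact hw.trans hle

end Drift

end Model

end Perpetuity

/-! ### Lower bounds for the probability of termination -/

namespace Perpetuity

lemma exists_pos_forall_le {ι : Type*} [Finite ι] {f : ι → ℝ} (hf : ∀ i, 0 < f i) :
    ∃ ε, 0 < ε ∧ ε ≤ 1 ∧ ∀ i, ε ≤ f i := by
  have h : ∀ᶠ ε : ℝ in 𝓝[>] 0, 0 < ε ∧ ε ≤ 1 ∧ ∀ i, ε ≤ f i := by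
    have h1 : ∀ᶠ ε : ℝ in 𝓝[>] 0, ∀ i, ε ≤ f i := eventually_all.2 fun i =>
      nhdsWithin_le_nhds ((gt_mem_nhds (hf i)).mono fun ε h => h.le)
    have h2 : ∀ᶠ ε : ℝ in 𝓝[>] 0, ε ≤ 1 :=
      nhdsWithin_le_nhds ((gt_mem_nhds one_pos).mono fun ε h => h.le)
    filter_upwards [self_mem_nhdsWithin, h1, h2] with ε a b c using ⟨a, c, b⟩
  exact h.exists

/-- The states in which the sampler has not terminated. -/
def alive (S : Type*) : Set (S × ℝ) := {q | 0 < q.2}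

lemma measurableSet_alive {S : Type*} [MeasurableSpace S] : MeasurableSet (alive S) :=
  measurableSet_lt measurable_const measurable_snd

/-- The Lyapunov function `z₊ ^ s * h x`. -/
noncomputable def lyapunov {S : Type*} (s : ℝ) (h : S → ℝ) (q : S × ℝ) : ℝ :=
  max q.2 0 ^ s * h q.1

lemma lyapunov_nonneg {S : Type*} {s : ℝ} {h : S → ℝ} (hh : ∀ x, 0 < h x) (q : S × ℝ) :
    0 ≤ lyapunov s h q :=
  mul_nonneg (Real.rpow_nonneg (le_max_right _ _) _) (hh _).le

lemma measurable_lyapunov {S : Type*} [Fintype S] [MeasurableSpace S] [MeasurableSingletonClass S]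
    (s : ℝ) (h : S → ℝ) : Measurable (lyapunov s h) := by
  have h1 : Measurable h := measurable_of_countable h
  unfold lyapunov
  fun_prop

namespace Model

variable {S : Type*} [Fintype S] [DecidableEq S] {M : Model S}

/-- Rewards are nonnegative, so discarding them can only increase the positive part. -/
lemma lyapunov_move_le {s Δ : ℝ} {h : S → ℝ} (hs : 0 < s) (hΔ : 0 < Δ) (hh : ∀ x, 0 < h x)
    (y : S) (z : ℝ) (w : ℝ × ℝ) :
    lyapunov s h (M.move Δ y z w) ≤ max z 0 ^ s * (Real.exp (-s * M.γ y w.1) * h y) := by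
  have h1 : Real.exp (-s * M.γ y w.1) = Real.exp (-M.γ y w.1) ^ s := by
    rw [← Real.exp_mul]; ring_nf
  have h2 : max (z * Real.exp (-M.γ y w.1) - Δ * M.lam y w.2) 0 ≤
      max z 0 * Real.exp (-M.γ y w.1) := by
    have := mul_nonneg hΔ.le (M.lam_nonneg y w.2)
    refine max_le ?_ (by positivity)
    have := mul_le_mul_of_nonneg_right (le_max_left z 0) (Real.exp_pos (-M.γ y w.1)).le
    linarith
  rw [h1, ← mul_assoc, ← Real.mul_rpow (le_max_right _ _) (Real.exp_pos _).le]
  exact mul_le_mul_of_nonneg_right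
    (Real.rpow_le_rpow (le_max_right _ _) h2 hs.le) (hh y).le

lemma exists_gamma_ge (y : S) : ∃ m : ℕ, M.ν {w | -(m : ℝ) ≤ M.γ y w.1} ≠ 0 := by
  have := M.prob_ν
  by_contra! h
  have h1 := measure_iUnion_null h
  have h2 : (⋃ m : ℕ, {w : ℝ × ℝ | -(m : ℝ) ≤ M.γ y w.1}) = Set.univ := by
    refine Set.eq_univ_of_forall fun w => Set.mem_iUnion.2 ?_
    obtain ⟨m, hm⟩ := exists_nat_ge (-M.γ y w.1)
    exact ⟨m, show -(m : ℝ) ≤ M.γ y w.1 by linarith⟩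
  rw [h2] at h1
  simp at h1

/-- Countably many such events cover that of a positive reward. On one of them `z` grows by at most
`exp m` while the reward takes off at least `Δ / (m + 1)`. -/
lemma exists_gamma_ge_lam_ge {y : S} (hy : 0 < M.ν {w | 0 < M.lam y w.2}) :
    ∃ m : ℕ, M.ν {w | -(m : ℝ) ≤ M.γ y w.1 ∧ 1 / ((m : ℝ) + 1) ≤ M.lam y w.2} ≠ 0 := by
  by_contra! h
  have h1 := measure_iUnion_null h
  refine hy.ne' (measure_mono_null (fun w hw => Set.mem_iUnion.2 ?_) h1)
  obtain ⟨m, hm⟩ := exists_nat_ge (-M.γ y w.1)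
  obtain ⟨n, hn⟩ := exists_nat_one_div_lt (show 0 < M.lam y w.2 from hw)
  refine ⟨max m n, ?_, ?_⟩
  · have : (m : ℝ) ≤ ((max m n : ℕ) : ℝ) := by exact_mod_cast le_max_left m n
    linarith
  · refine le_trans ?_ hn.le
    have : (n : ℝ) ≤ ((max m n : ℕ) : ℝ) := by exact_mod_cast le_max_right m n
    exact one_div_le_one_div_of_le (by positivity) (by linarith)

variable [MeasurableSpace S]

/-- `κ` applies exponential tilting above the threshold `b` and the nominal dynamics below. -/
structure IsSampler (M : Model S) (θ : ℝ) (v : S → ℝ) (Δ : ℝ) (b : S → ℝ)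
    (κ : Kernel (S × ℝ) (S × ℝ)) : Prop where
  tilted : ∀ x z, b x < z → κ (x, z) = M.tiltedStep θ v Δ x z
  nominal : ∀ x z, z ≤ b x → κ (x, z) = M.nominalStep Δ x z

lemma measurable_move_right (Δ : ℝ) (y : S) (z : ℝ) : Measurable (M.move Δ y z) :=
  (M.measurable_move Δ y).comp measurable_prodMk_left

variable {θ : ℝ} {v : S → ℝ}

/-- An event of positive probability for the driving noise has, along a possible transition of the
chain, a probability bounded below uniformly over the dynamics. -/
lemma exists_le_step (hψ : M.psi θ = 0) (hv : M.IsPerronVector θ v) {x y : S}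
    (hK : 0 < M.K x y) {F : Set (ℝ × ℝ)} (hF : M.ν F ≠ 0) :
    ∃ ε, 0 < ε ∧ ε ≤ 1 ∧ ∀ (Δ : ℝ) (b : S → ℝ) (κ : Kernel (S × ℝ) (S × ℝ)),
      M.IsSampler θ v Δ b κ → ∀ (z : ℝ) (B : Set (S × ℝ)), MeasurableSet B →
        (∀ w ∈ F, M.move Δ y z w ∈ B) → ENNReal.ofReal ε ≤ κ (x, z) B := by
  have hfin := mgfFinite_of_psi_eq_zero hψ
  have := M.prob_ν
  have := isProbabilityMeasure_tilted (hfin y)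
  set τ := M.ν.tilted fun w : ℝ × ℝ => θ * M.γ y w.1
  -- Tilting by a positive density keeps `F` non-null, so one bound can serve on both sides of the
  -- threshold.
  have hτ : τ F ≠ 0 := fun h => hF (absolutelyContinuous_tilted (hfin y) h)
  have key : ∀ {a : S → ℝ} {μ : S → Measure (ℝ × ℝ)} {Δ z : ℝ} {B : Set (S × ℝ)},
      MeasurableSet B → (∀ w ∈ F, M.move Δ y z w ∈ B) →
      ENNReal.ofReal (a y) * μ y F ≤
        (∑ y, ENNReal.ofReal (a y) • (μ y).map (M.move Δ y z)) B := by
    intro a μ Δ z B hB hFB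
    rw [Measure.finsetSum_apply]
    refine le_trans ?_ (Finset.single_le_sum (f := fun y =>
      (ENNReal.ofReal (a y) • (μ y).map (M.move Δ y z)) B) (fun _ _ => zero_le)
      (Finset.mem_univ y))
    simp only [Measure.smul_apply, smul_eq_mul]
    rw [Measure.map_apply (measurable_move_right Δ y z) hB]
    exact mul_le_mul_right (measure_mono hFB) _
  have hν' : 0 < (M.ν F).toReal := ENNReal.toReal_pos hF (measure_ne_top _ _)
  have hτ' : 0 < (τ F).toReal := ENNReal.toReal_pos hτ (measure_ne_top _ _)
  have hKt := tiltedK_pos hv hK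
  refine ⟨min 1 (min (M.K x y * (M.ν F).toReal) (M.tiltedK θ v x y * (τ F).toReal)),
    by positivity, min_le_left _ _, fun Δ b κ hκ z B hB hFB => ?_⟩
  rcases lt_or_ge (b x) z with hz | hz
  · rw [hκ.tilted x z hz]
    refine le_trans ?_ (key (a := M.tiltedK θ v x)
      (μ := fun y => M.ν.tilted fun w => θ * M.γ y w.1) hB hFB)
    calc _ ≤ ENNReal.ofReal (M.tiltedK θ v x y * (τ F).toReal) :=
          ENNReal.ofReal_le_ofReal ((min_le_right _ _).trans (min_le_right _ _))
      _ = _ := by rw [ENNReal.ofReal_mul hKt.le, ENNReal.ofReal_toReal (measure_ne_top _ _)]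
  · rw [hκ.nominal x z hz]
    refine le_trans ?_ (key (a := M.K x) (μ := fun _ => M.ν) hB hFB)
    calc _ ≤ ENNReal.ofReal (M.K x y * (M.ν F).toReal) :=
          ENNReal.ofReal_le_ofReal ((min_le_right _ _).trans (min_le_left _ _))
      _ = _ := by rw [ENNReal.ofReal_mul hK.le, ENNReal.ofReal_toReal (measure_ne_top _ _)]

variable [MeasurableSingletonClass S]

/-- Along a path of positive probability to `xs`, `z` grows by a bounded factor; if it starts small
enough relative to `Δ`, the reward at `xs` exceeds what is left. -/
lemma exists_death_of_pow_pos (hψ : M.psi θ = 0) (hv : M.IsPerronVector θ v) {xs : S}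
    (hxs : 0 < M.ν {w | 0 < M.lam xs w.2}) (k : ℕ) (x : S) (hk : 0 < (M.K ^ (k + 1)) x xs) :
    ∃ (L : ℕ) (ε d : ℝ), 0 < ε ∧ 0 < d ∧ d ≤ 1 ∧
      ∀ (Δ : ℝ) (b : S → ℝ) (κ : Kernel (S × ℝ) (S × ℝ)) [IsMarkovKernel κ], 0 < Δ →
      M.IsSampler θ v Δ b κ → ∀ z, z ≤ ε * Δ →
        survival κ (alive S) L (x, z) + ENNReal.ofReal d ≤ 1 := by
  induction k generalizing x with
  | zero =>
    rw [zero_add, pow_one] at hk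
    obtain ⟨m, hm⟩ := exists_gamma_ge_lam_ge hxs
    obtain ⟨e, he0, he1, he⟩ := exists_le_step hψ hv hk hm
    -- Chosen so that growth by `exp m` brings `z` to at most the guaranteed reward `Δ / (m + 1)`.
    refine ⟨1, 1 / ((m : ℝ) + 1) * Real.exp (-m), e, by positivity, he0, he1, ?_⟩
    intro Δ b κ _ hΔ hκ z hz
    have hB : MeasurableSet {q : S × ℝ | q.2 ≤ 0} := measurableSet_le measurable_snd measurable_const
    -- The target set is disjoint from `alive S`, so the hypothesis is vacuous and `d = 1` is
    -- allowed.
    have := survival_succ_add_le κ (B := {q : S × ℝ | q.2 ≤ 0}) (measurableSet_alive (S := S)) hB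
      (n := 0) (d := 1) le_rfl (fun q hq => absurd (show 0 < q.2 from hq.1) (not_lt.2 hq.2))
      (he Δ b κ hκ z _ hB ?_)
    · simpa using this
    · rintro w ⟨hw1, hw2⟩
      show z * Real.exp (-M.γ xs w.1) - Δ * M.lam xs w.2 ≤ 0
      have h1 : z * Real.exp (-M.γ xs w.1) ≤
          (1 / ((m : ℝ) + 1) * Real.exp (-m) * Δ) * Real.exp m :=
        (mul_le_mul_of_nonneg_right hz (Real.exp_pos _).le).trans
          (mul_le_mul_of_nonneg_left (Real.exp_le_exp.2 (by linarith)) (by positivity))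
      have h2 : (1 / ((m : ℝ) + 1) * Real.exp (-m) * Δ) * Real.exp m = Δ * (1 / ((m : ℝ) + 1)) := by
        rw [Real.exp_neg]
        field_simp
      have := mul_le_mul_of_nonneg_left hw2 hΔ.le
      linarith
  | succ k ih =>
    obtain ⟨y, hxy, hy⟩ : ∃ y, 0 < M.K x y ∧ 0 < (M.K ^ (k + 1)) y xs := by
      by_contra! hcon
      rw [pow_succ', Matrix.mul_apply] at hk
      refine absurd hk (not_lt.2 (Finset.sum_nonpos fun y _ => ?_))
      rcases (M.K_nonneg x y).eq_or_lt with h0 | h0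
      · simp [← h0]
      · exact mul_nonpos_of_nonneg_of_nonpos h0.le (hcon y h0)
    obtain ⟨L, ε, d, hε, hd0, hd1, hL⟩ := ih y hy
    obtain ⟨m, hm⟩ := M.exists_gamma_ge y
    obtain ⟨e, he0, he1, he⟩ := exists_le_step hψ hv hxy hm
    refine ⟨L + 1, ε * Real.exp (-m), e * d, by positivity, by positivity,
      mul_le_one₀ he1 hd0.le hd1, ?_⟩
    intro Δ b κ _ hΔ hκ z hz
    have hB : MeasurableSet {q : S × ℝ | q.1 = y ∧ q.2 ≤ ε * Δ} :=
      (measurable_fst (measurableSet_singleton y)).inter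
        (measurableSet_le measurable_snd measurable_const)
    rw [ENNReal.ofReal_mul he0.le]
    refine survival_succ_add_le κ (measurableSet_alive (S := S)) hB (ENNReal.ofReal_le_one.2 hd1) ?_
      (he Δ b κ hκ z _ hB ?_)
    · rintro ⟨y', z'⟩ ⟨-, hy', hz'⟩
      simp only at hy' hz'
      subst hy'
      exact hL Δ b κ hΔ hκ z' hz'
    · intro w hw
      refine ⟨rfl, ?_⟩
      have hw' : -(m : ℝ) ≤ M.γ y w.1 := hw
      show z * Real.exp (-M.γ y w.1) - Δ * M.lam y w.2 ≤ ε * Δ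
      have h1 : z * Real.exp (-M.γ y w.1) ≤ (ε * Real.exp (-m) * Δ) * Real.exp m :=
        (mul_le_mul_of_nonneg_right hz (Real.exp_pos _).le).trans
          (mul_le_mul_of_nonneg_left (Real.exp_le_exp.2 (by linarith)) (by positivity))
      have h2 : (ε * Real.exp (-m) * Δ) * Real.exp m = ε * Δ := by
        rw [Real.exp_neg]
        field_simp
      have := mul_nonneg hΔ.le (M.lam_nonneg y w.2)
      linarith

/-- Close to the boundary the sampler terminates within a bounded number of steps with a
probability that is bounded below. -/
lemma exists_death_near (hψ : M.psi θ = 0) (hv : M.IsPerronVector θ v)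
    (hirr : M.K.IsIrreducible) (hlam : M.RewardNontrivial) :
    ∃ (L : ℕ) (ε d : ℝ), 0 < ε ∧ 0 < d ∧ d ≤ 1 ∧
      ∀ (Δ : ℝ) (b : S → ℝ) (κ : Kernel (S × ℝ) (S × ℝ)) [IsMarkovKernel κ], 0 < Δ →
      M.IsSampler θ v Δ b κ → ∀ x z, z ≤ ε * Δ →
        survival κ (alive S) L (x, z) + ENNReal.ofReal d ≤ 1 := by
  obtain ⟨xs, hxs⟩ := hlam
  have hall : ∀ x : S, ∃ k : ℕ, 0 < (M.K ^ (k + 1)) x xs := fun x => by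
    obtain ⟨k, hk0, hk⟩ := (Matrix.isIrreducible_iff_exists_pow_pos M.K_nonneg).1 hirr x xs
    exact ⟨k - 1, by rwa [Nat.sub_add_cancel hk0]⟩
  choose k hk using hall
  choose L ε d hε hd0 hd1 hL using fun x => exists_death_of_pow_pos hψ hv hxs (k x) x (hk x)
  obtain ⟨ε', hε'0, -, hε'⟩ := exists_pos_forall_le hε
  obtain ⟨d', hd'0, hd'1, hd'⟩ := exists_pos_forall_le hd0
  refine ⟨Finset.univ.sup L, ε', d', hε'0, hd'0, hd'1, fun Δ b κ _ hΔ hκ x z hz => ?_⟩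
  refine le_trans (add_le_add (survival_antitone κ _ _ (Finset.le_sup (Finset.mem_univ x)))
    (ENNReal.ofReal_le_ofReal (hd' x))) (hL x Δ b κ hΔ hκ z ?_)
  exact hz.trans (mul_le_mul_of_nonneg_right (hε' x) hΔ.le)

/-- The death probability at higher levels of the Lyapunov function, level by level. -/
lemma exists_death_descend (hψ : M.psi θ = 0) (hv : M.IsPerronVector θ v) {s ζ : ℝ} {h : S → ℝ}
    (hs0 : 0 < s) (hζ : 0 < ζ) (hh : ∀ x, 0 < h x) (hs : M.MgfFinite (θ - s))
    (hdrift : ∀ x, ∑ y, M.tiltedK θ v x y *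
      ((∫ w, Real.exp (-s * M.γ y w.1) ∂(M.ν.tilted fun w => θ * M.γ y w.1)) * h y) ≤ ζ * h x) :
    ∃ e, 0 < e ∧ e ≤ 1 ∧
      ∀ (Δ : ℝ) (b : S → ℝ) (κ : Kernel (S × ℝ) (S × ℝ)) [IsMarkovKernel κ], 0 < Δ →
      M.IsSampler θ v Δ b κ → ∀ (n : ℕ) (d r : ℝ), 0 ≤ d → d ≤ 1 →
      (∀ q, lyapunov s h q ≤ r → survival κ (alive S) n q + ENNReal.ofReal d ≤ 1) →
      ∀ (m : ℕ) (q), lyapunov s h q * ζ ^ m ≤ r →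
        survival κ (alive S) (n + m) q + ENNReal.ofReal (e ^ m * d) ≤ 1 := by
  choose y hy hF using fun x => exists_successor_decrease hψ hv hs (hdrift x)
  choose ε hε0 hε1 hε using fun x => exists_le_step hψ hv (hy x) (hF x)
  obtain ⟨e, he0, he1, he⟩ := exists_pos_forall_le hε0
  refine ⟨e, he0, he1, fun Δ b κ _ hΔ hκ n d r hd0 hd1 hbase m => ?_⟩
  induction m with
  | zero => simpa using hbase
  | succ m ih =>
    rintro ⟨x, z⟩ hq
    -- Level set one factor `ζ` lower; it is entered in one step with probability at least `e`.
    have hB : MeasurableSet {q : S × ℝ | lyapunov s h q * ζ ^ m ≤ r} :=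
      measurableSet_le ((measurable_lyapunov s h).mul_const _) measurable_const
    rw [pow_succ', mul_assoc, ENNReal.ofReal_mul he0.le, ← add_assoc]
    refine survival_succ_add_le κ (measurableSet_alive (S := S)) hB
      (ENNReal.ofReal_le_one.2 (mul_le_one₀ (pow_le_one₀ he0.le he1) hd0 hd1)) ?_
      ((ENNReal.ofReal_le_ofReal (he x)).trans (hε x Δ b κ hκ z _ hB ?_))
    · exact fun q hq => ih q hq.2
    · intro w hw
      have hw' : Real.exp (-s * M.γ (y x) w.1) * h (y x) ≤ ζ * h x := hw
      show lyapunov s h (M.move Δ (y x) z w) * ζ ^ m ≤ r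
      refine le_trans ?_ hq
      rw [pow_succ', ← mul_assoc]
      refine mul_le_mul_of_nonneg_right ?_ (pow_nonneg hζ.le m)
      refine (lyapunov_move_le hs0 hΔ hh (y x) z w).trans ?_
      calc _ ≤ max z 0 ^ s * (ζ * h x) :=
            mul_le_mul_of_nonneg_left hw' (Real.rpow_nonneg (le_max_right _ _) _)
        _ = lyapunov s h (x, z) * ζ := by simp only [lyapunov]; ring

/-- Below a threshold of order `c Δ` the sampler terminates within `O(log c)` steps with a
probability of at least `c ^ (-p)`. -/
lemma exists_death_below (hψ : M.psi θ = 0) (hv : M.IsPerronVector θ v)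
    (hirr : M.K.IsIrreducible) (hlam : M.RewardNontrivial) {s ζ : ℝ} {h : S → ℝ}
    (hs0 : 0 < s) (hζ : 0 < ζ) (hζ1 : ζ < 1) (hh : ∀ x, 0 < h x) (hs : M.MgfFinite (θ - s))
    (hdrift : ∀ x, ∑ y, M.tiltedK θ v x y *
      ((∫ w, Real.exp (-s * M.γ y w.1) ∂(M.ν.tilted fun w => θ * M.γ y w.1)) * h y) ≤ ζ * h x)
    {R : ℝ} (hR : 0 < R) :
    ∃ p C : ℝ, 0 < p ∧ 0 < C ∧ ∀ c : ℝ, 2 ≤ c → ∃ N : ℕ, (N : ℝ) ≤ C * Real.log c ∧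
      ∀ (Δ : ℝ) (b : S → ℝ) (κ : Kernel (S × ℝ) (S × ℝ)) [IsMarkovKernel κ], 0 < Δ →
      M.IsSampler θ v Δ b κ → ∀ x z, z ≤ R * (c * Δ) →
        survival κ (alive S) N (x, z) + ENNReal.ofReal (c ^ (-p)) ≤ 1 := by
  obtain ⟨L, ε, d, hε, hd0, hd1, hL⟩ := exists_death_near hψ hv hirr hlam
  obtain ⟨e, he0, he1, he⟩ := exists_death_descend hψ hv hs0 hζ hh hs hdrift
  obtain ⟨hm, hm0, -, hhm⟩ := exists_pos_forall_le hh
  have hH : ∃ H, 0 < H ∧ ∀ x, h x ≤ H := by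
    refine ⟨∑ x, h x + 1, by have := Finset.sum_nonneg fun x (_ : x ∈ Finset.univ) => (hh x).le
                             linarith, fun x => ?_⟩
    have := Finset.single_le_sum (fun x _ => (hh x).le) (Finset.mem_univ x)
    linarith
  obtain ⟨H, hH0, hH⟩ := hH
  set lz := -Real.log ζ with hlz
  have hlz0 : 0 < lz := neg_pos.2 (Real.log_neg hζ hζ1)
  -- `Q * c ^ s` is the ratio between the largest Lyapunov value on `z ≤ R c Δ` and the level that
  -- forces `z ≤ ε Δ`; `m` below is the number of factors `ζ` that absorbs it.
  set Q := (R / ε) ^ s * (H / hm) with hQ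
  have hQ0 : 0 < Q := by positivity
  have hl2 : 0 < Real.log 2 := Real.log_pos one_lt_two
  set a := (|Real.log Q| / Real.log 2 + s) / lz + 1 / Real.log 2 with ha
  have ha0 : 0 < a := by positivity
  have hle0 : 0 ≤ -Real.log e := neg_nonneg.2 (Real.log_nonpos he0.le he1)
  have hld0 : 0 ≤ -Real.log d := neg_nonneg.2 (Real.log_nonpos hd0.le hd1)
  -- From `m ≤ a log c`, and constants absorbed through `log c ≥ log 2`, the exponent makes `c ^
  -- (-p) ≤ e ^ m * d`; the `1` keeps it positive when `e = d = 1`.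
  refine ⟨(-Real.log e) * a + (-Real.log d) / Real.log 2 + 1, L / Real.log 2 + a,
    by positivity, by positivity, fun c hc => ?_⟩
  have hc0 : 0 < c := by linarith
  have hlc : Real.log 2 ≤ Real.log c := Real.log_le_log two_pos hc
  have hlc0 : 0 < Real.log c := hl2.trans_le hlc
  have hge : ∀ {t : ℝ}, 0 ≤ t → t ≤ t / Real.log 2 * Real.log c := fun {t} ht => by
    rw [div_mul_eq_mul_div, le_div_iff₀ hl2]
    exact mul_le_mul_of_nonneg_left hlc ht
  set m := ⌈(Real.log Q + s * Real.log c) / lz⌉₊ with hmdef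
  have hm1 : (Real.log Q + s * Real.log c) / lz ≤ m := Nat.le_ceil _
  have hm2 : (m : ℝ) ≤ a * Real.log c := by
    have h1 : (Real.log Q + s * Real.log c) / lz ≤
        (|Real.log Q| / Real.log 2 + s) / lz * Real.log c := by
      rw [div_mul_eq_mul_div]
      refine div_le_div_of_nonneg_right ?_ hlz0.le
      have := hge (abs_nonneg (Real.log Q))
      have := le_abs_self (Real.log Q)
      linarith
    have h2 : (m : ℝ) < (|Real.log Q| / Real.log 2 + s) / lz * Real.log c + 1 :=
      (Nat.cast_le.2 (Nat.ceil_mono h1)).trans_lt (Nat.ceil_lt_add_one (by positivity))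
    have := hge zero_le_one
    rw [ha, add_mul]
    linarith
  refine ⟨L + m, ?_, ?_⟩
  · push_cast
    have := hge (Nat.cast_nonneg (α := ℝ) L)
    rw [add_mul]
    linarith
  intro Δ b κ _ hΔ hκ x z hz
  have hbase : ∀ q, lyapunov s h q ≤ (ε * Δ) ^ s * hm →
      survival κ (alive S) L q + ENNReal.ofReal d ≤ 1 := by
    rintro ⟨x', z'⟩ hq
    refine hL Δ b κ hΔ hκ x' z' (le_of_not_gt fun hlt => ?_)
    have h1 : (ε * Δ) ^ s < max z' 0 ^ s :=
      Real.rpow_lt_rpow (by positivity) (hlt.trans_le (le_max_left _ _)) hs0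
    have h2 : (ε * Δ) ^ s * hm < lyapunov s h (x', z') :=
      (mul_lt_mul_of_pos_right h1 hm0).trans_le
        (mul_le_mul_of_nonneg_left (hhm x') (Real.rpow_nonneg (le_max_right _ _) _))
    exact absurd hq (not_le.2 h2)
  have hmain := he Δ b κ hΔ hκ L d _ hd0.le hd1 hbase m (x, z) ?_
  · refine le_trans (add_le_add le_rfl (ENNReal.ofReal_le_ofReal ?_)) hmain
    rw [← Real.exp_log he0, ← Real.exp_nat_mul, ← Real.exp_log hd0, ← Real.exp_add,
      Real.rpow_def_of_pos hc0, Real.exp_le_exp]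
    rw [Real.exp_log he0, Real.exp_log hd0]
    have h1 := hge hld0
    have h2 := mul_le_mul_of_nonneg_left hm2 hle0
    nlinarith
  · have h1 : lyapunov s h (x, z) ≤ (R * (c * Δ)) ^ s * H := by
      refine mul_le_mul (Real.rpow_le_rpow (le_max_right _ _)
        (max_le hz (by positivity)) hs0.le) (hH x) (hh x).le (by positivity)
    have h2 : Q * c ^ s * ζ ^ m ≤ 1 := by
      rw [div_le_iff₀ hlz0] at hm1
      rw [← Real.exp_log hQ0, Real.rpow_def_of_pos hc0, ← Real.exp_log hζ, ← Real.exp_nat_mul,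
        ← Real.exp_add, ← Real.exp_add, Real.exp_le_one_iff]
      rw [hlz] at hm1
      linarith
    have h3 : (R * (c * Δ)) ^ s * H = (ε * Δ) ^ s * hm * (Q * c ^ s) := by
      have : R * (c * Δ) = (ε * Δ) * (R / ε) * c := by field_simp
      rw [this, Real.mul_rpow (by positivity) hc0.le, Real.mul_rpow (by positivity) (by positivity),
        hQ]
      field_simp
    calc lyapunov s h (x, z) * ζ ^ m ≤ (R * (c * Δ)) ^ s * H * ζ ^ m :=
          mul_le_mul_of_nonneg_right h1 (by positivity)
      _ = (ε * Δ) ^ s * hm * (Q * c ^ s * ζ ^ m) := by rw [h3]; ring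
      _ ≤ (ε * Δ) ^ s * hm * 1 := mul_le_mul_of_nonneg_left h2 (by positivity)
      _ = _ := mul_one _

end Model

end Perpetuity

/-! ### Concavity bounds for the logarithm -/

namespace Real

/-- The tangent line bound for the logarithm at `1 + a`. -/
lemma log_one_add_le_tangent {a x : ℝ} (ha : 0 ≤ a) (hx : 0 ≤ x) :
    Real.log (1 + x) ≤ (Real.log (1 + a) - a / (1 + a)) + x / (1 + a) := by
  have h1 : 0 < 1 + a := by linarith
  have h2 : 0 < 1 + x := by linarith
  have h3 := Real.log_le_sub_one_of_pos (div_pos h2 h1)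
  rw [Real.log_div h2.ne' h1.ne'] at h3
  have h4 : (1 + x) / (1 + a) - 1 = x / (1 + a) - a / (1 + a) := by field_simp; ring
  linarith

/-- The tangent at `x = 0`. It makes the intercept of the tangent line nonnegative, so that
`ENNReal.ofReal` splits over the sum. -/
lemma div_one_add_le_log {a : ℝ} (ha : 0 ≤ a) :
    a / (1 + a) ≤ Real.log (1 + a) := by
  have := log_one_add_le_tangent ha le_rfl
  simp at this
  linarith

end Real

/-! ### Drift of the logarithmic Lyapunov function and the bound at fixed `Δ` -/

namespace Perpetuity

/-- Logarithm of the Lyapunov function at scale `β`. -/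
noncomputable def logLyapunov {S : Type*} (s β : ℝ) (h : S → ℝ) (q : S × ℝ) : ℝ :=
  Real.log (1 + lyapunov s h q / β ^ s)

/-- Source of the logarithmic dependence on the starting height in the final bound. -/
lemma logLyapunov_le {S : Type*} {s β : ℝ} {h : S → ℝ} (hs : 0 < s) (hβ : 0 < β) (hh : ∀ x, 0 < h x)
    {H : ℝ} (hH : ∀ x, h x ≤ H) (q : S × ℝ) :
    logLyapunov s β h q ≤ Real.log (1 + H) + s * Real.log (1 + max q.2 0 / β) := by
  have hH0 : 0 < H := (hh q.1).trans_le (hH q.1)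
  have hr : 0 ≤ max q.2 0 / β := div_nonneg (le_max_right _ _) hβ.le
  have h1 : 0 < 1 + max q.2 0 / β := by linarith
  rw [← Real.log_rpow h1, ← Real.log_mul (by positivity) (by positivity), logLyapunov]
  refine Real.log_le_log ?_ ?_
  · have : 0 ≤ lyapunov s h q / β ^ s := div_nonneg (lyapunov_nonneg hh q) (by positivity)
    linarith
  · have h2 : lyapunov s h q / β ^ s = (max q.2 0 / β) ^ s * h q.1 := by
      rw [Real.div_rpow (le_max_right _ _) hβ.le, lyapunov]
      ring
    have h3 : (max q.2 0 / β) ^ s ≤ (1 + max q.2 0 / β) ^ s :=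
      Real.rpow_le_rpow hr (by linarith) hs.le
    have h4 : 1 ≤ (1 + max q.2 0 / β) ^ s := Real.one_le_rpow (by linarith) hs.le
    have h5 := mul_le_mul h3 (hH q.1) (hh _).le (by linarith)
    rw [h2]
    linarith


namespace Model

variable {S : Type*} [Fintype S] [DecidableEq S] {M : Model S} [MeasurableSpace S]
  [MeasurableSingletonClass S] {θ : ℝ} {v : S → ℝ}

/-- Weights and noise laws are left arbitrary so that the tilted and the nominal step are both
instances. -/
lemma lintegral_lyapunov_step_le {s Δ : ℝ} {h : S → ℝ} (hs : 0 < s) (hΔ : 0 < Δ)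
    (hh : ∀ x, 0 < h x) {a : S → ℝ} (ha : ∀ y, 0 ≤ a y) {μ : S → Measure (ℝ × ℝ)}
    (hint : ∀ y, Integrable (fun w : ℝ × ℝ => Real.exp (-s * M.γ y w.1)) (μ y)) (z : ℝ) :
    ∫⁻ q, ENNReal.ofReal (lyapunov s h q)
        ∂(∑ y, ENNReal.ofReal (a y) • (μ y).map (M.move Δ y z)) ≤
      ENNReal.ofReal (max z 0 ^ s *
        ∑ y, a y * ((∫ w, Real.exp (-s * M.γ y w.1) ∂μ y) * h y)) := by
  have hz : 0 ≤ max z 0 ^ s := Real.rpow_nonneg (le_max_right _ _) _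
  have hI : ∀ y, 0 ≤ (∫ w, Real.exp (-s * M.γ y w.1) ∂μ y) * h y := fun y =>
    mul_nonneg (integral_nonneg fun w => (Real.exp_pos _).le) (hh y).le
  rw [lintegral_finsetSum_measure, Finset.mul_sum, ENNReal.ofReal_sum_of_nonneg
    fun y _ => mul_nonneg hz (mul_nonneg (ha y) (hI y))]
  refine Finset.sum_le_sum fun y _ => ?_
  rw [lintegral_smul_measure, smul_eq_mul, mul_left_comm, ENNReal.ofReal_mul (ha y),
    lintegral_map (measurable_lyapunov s h).ennreal_ofReal (measurable_move_right Δ y z)]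
  refine mul_le_mul_right ?_ _
  calc _ ≤ ∫⁻ w, ENNReal.ofReal (max z 0 ^ s * (Real.exp (-s * M.γ y w.1) * h y)) ∂μ y :=
        lintegral_mono fun w => ENNReal.ofReal_le_ofReal (lyapunov_move_le hs hΔ hh y z w)
    _ = _ := by
        rw [← ofReal_integral_eq_lintegral_ofReal (((hint y).mul_const _).const_mul _)
          (ae_of_all _ fun w => mul_nonneg hz (mul_nonneg (Real.exp_pos _).le (hh y).le)),
          integral_const_mul, integral_mul_const]

/-- The drift of `logLyapunov`: uniformly negative above the threshold and bounded below it. -/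
lemma exists_drift (hψ : M.psi θ = 0) (hv : M.IsPerronVector θ v) {s ζ : ℝ} {h : S → ℝ}
    (hs0 : 0 < s) (hζ1 : ζ < 1) (hh : ∀ x, 0 < h x) (hs : M.MgfFinite (θ - s))
    (hsneg : M.MgfFinite (-s))
    (hdrift : ∀ x, ∑ y, M.tiltedK θ v x y *
      ((∫ w, Real.exp (-s * M.γ y w.1) ∂(M.ν.tilted fun w => θ * M.γ y w.1)) * h y) ≤ ζ * h x)
    {R : ℝ} (hR : 0 < R) :
    ∃ k C : ℝ, 0 < k ∧ 0 < C ∧ ∀ (Δ β : ℝ) (b : S → ℝ) (κ : Kernel (S × ℝ) (S × ℝ))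
      [IsMarkovKernel κ], 0 < Δ → 0 < β → (∀ x, β / R ≤ b x) → (∀ x, b x ≤ R * β) → M.IsSampler θ v Δ b κ → ∀ q,
        ∫⁻ q', ENNReal.ofReal (logLyapunov s β h q') ∂κ q + ENNReal.ofReal k ≤
          ENNReal.ofReal (logLyapunov s β h q) +
            Set.indicator {q | q.2 ≤ R * β} (fun _ => ENNReal.ofReal C) q := by
  have hfin := mgfFinite_of_psi_eq_zero hψ
  obtain ⟨hm, hm0, -, hhm⟩ := exists_pos_forall_le hh
  -- Lower bound for `W / β ^ s` above the threshold. With `a` the current value of `W / β ^ s`, the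
  -- tangent at `a` gives a decrease of `(1 - ζ) a / (1 + a)`, which is increasing in `a`; hence
  -- `k`.
  set w0 := (1 / R) ^ s * hm with hw0
  have hw0' : 0 < w0 := by positivity
  set k := (1 - ζ) * (w0 / (1 + w0)) with hk
  have hk0 : 0 < k := mul_pos (by linarith) (by positivity)
  -- Bounds the mean of `W / β ^ s` after a nominal step; the sum over `x` stands in for a maximum.
  set C0 := R ^ s * ∑ x, ∑ y, M.K x y * ((∫ w, Real.exp (-s * M.γ y w.1) ∂M.ν) * h y) with hC0
  have hI : ∀ x y, 0 ≤ M.K x y * ((∫ w, Real.exp (-s * M.γ y w.1) ∂M.ν) * h y) := fun x y =>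
    mul_nonneg (M.K_nonneg x y)
      (mul_nonneg (integral_nonneg fun w => (Real.exp_pos _).le) (hh y).le)
  have hC00 : 0 ≤ C0 := mul_nonneg (by positivity)
    (Finset.sum_nonneg fun x _ => Finset.sum_nonneg fun y _ => hI x y)
  refine ⟨k, C0 + k, hk0, by positivity, ?_⟩
  rintro Δ β b κ _ hΔ hβ hbl hbu hκ ⟨x, z⟩
  have hβs : 0 < β ^ s := by positivity
  have hW : ∀ q, 0 ≤ lyapunov s h q / β ^ s := fun q => div_nonneg (lyapunov_nonneg hh q) hβs.le
  have hmeasL := measurable_lyapunov s h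
  rcases lt_or_ge (b x) z with hz | hz
  -- The indicator set contains the nominal region but may overlap the tilted one, where it is not
  -- needed.
  · refine le_trans ?_ le_self_add
    have hz0 : 0 < z := (div_pos hβ hR).trans_le ((hbl x).trans hz.le)
    set a := lyapunov s h (x, z) / β ^ s with ha
    have ha0 : 0 ≤ a := hW _
    have haw : w0 ≤ a := by
      rw [ha, le_div_iff₀ hβs, hw0, lyapunov, mul_right_comm,
        ← Real.mul_rpow (by positivity) hβ.le]
      refine mul_le_mul (Real.rpow_le_rpow (by positivity) ?_ hs0.le) (hhm x) hm0.le
        (Real.rpow_nonneg (le_max_right _ _) _)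
      rw [one_div_mul_eq_div]
      exact ((hbl x).trans hz.le).trans (le_max_left _ _)
    have hint : ∫⁻ q', ENNReal.ofReal (lyapunov s h q') ∂κ (x, z) ≤
        ENNReal.ofReal (ζ * (a * β ^ s)) := by
      rw [hκ.tilted x z hz]
      refine (lintegral_lyapunov_step_le hs0 hΔ hh (tiltedK_nonneg hv x)
        (fun y => integrable_exp_tilted hfin hs y) z).trans (ENNReal.ofReal_le_ofReal ?_)
      rw [ha, div_mul_cancel₀ _ hβs.ne', lyapunov, mul_left_comm]
      exact mul_le_mul_of_nonneg_left (hdrift x) (Real.rpow_nonneg (le_max_right _ _) _)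
    have hla : 0 ≤ Real.log (1 + a) - a / (1 + a) :=
      sub_nonneg.2 (Real.div_one_add_le_log ha0)
    have hca : 0 < β ^ s * (1 + a) := by positivity
    -- `0 ≤ ζ` is forced, since the left side of the drift inequality is nonnegative.
    by_cases hζ0 : 0 ≤ ζ
    swap
    · exfalso
      have h1 := hdrift x
      have h2 : 0 ≤ ζ * h x := le_trans (Finset.sum_nonneg fun y _ =>
        mul_nonneg (tiltedK_nonneg hv x y)
          (mul_nonneg (integral_nonneg fun w => (Real.exp_pos _).le) (hh y).le)) h1
      exact hζ0 (nonneg_of_mul_nonneg_left h2 (hh x))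
    calc ∫⁻ q', ENNReal.ofReal (logLyapunov s β h q') ∂κ (x, z) + ENNReal.ofReal k
        ≤ ∫⁻ q', ENNReal.ofReal (Real.log (1 + a) - a / (1 + a)) +
            ENNReal.ofReal (1 / (β ^ s * (1 + a))) * ENNReal.ofReal (lyapunov s h q') ∂κ (x, z) +
              ENNReal.ofReal k := by
          gcongr with q'
          rw [← ENNReal.ofReal_mul (by positivity), ← ENNReal.ofReal_add hla
            (mul_nonneg (by positivity) (lyapunov_nonneg hh _))]
          refine ENNReal.ofReal_le_ofReal
            ((Real.log_one_add_le_tangent ha0 (hW q')).trans_eq ?_)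
          field_simp
      _ ≤ ENNReal.ofReal (Real.log (1 + a) - a / (1 + a)) +
            ENNReal.ofReal (1 / (β ^ s * (1 + a))) * ENNReal.ofReal (ζ * (a * β ^ s)) +
              ENNReal.ofReal k := by
          rw [lintegral_add_left measurable_const, lintegral_const, measure_univ, mul_one,
            lintegral_const_mul _ hmeasL.ennreal_ofReal]
          gcongr
      _ = ENNReal.ofReal (Real.log (1 + a) - (1 - ζ) * (a / (1 + a)) + k) := by
          rw [← ENNReal.ofReal_mul (by positivity), ← ENNReal.ofReal_add hla (by positivity),
            ← ENNReal.ofReal_add (by positivity) hk0.le]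
          congr 1
          field_simp
          ring
      _ ≤ _ := by
          refine ENNReal.ofReal_le_ofReal ?_
          have h1 : w0 / (1 + w0) ≤ a / (1 + a) := by
            rw [div_le_div_iff₀ (by positivity) (by positivity)]
            linarith
          have h2 := mul_le_mul_of_nonneg_left h1 (show 0 ≤ 1 - ζ by linarith)
          rw [logLyapunov, ← ha]
          linarith
  · have hmem : (x, z) ∈ {q : S × ℝ | q.2 ≤ R * β} := hz.trans (hbu x)
    rw [Set.indicator_of_mem hmem, ENNReal.ofReal_add hC00 hk0.le, ← add_assoc]
    refine add_le_add (le_trans ?_ le_add_self) le_rfl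
    have hint : ∫⁻ q', ENNReal.ofReal (lyapunov s h q') ∂κ (x, z) ≤
        ENNReal.ofReal (β ^ s * C0) := by
      rw [hκ.nominal x z hz]
      refine (lintegral_lyapunov_step_le hs0 hΔ hh (M.K_nonneg x)
        (fun y => hsneg y) z).trans (ENNReal.ofReal_le_ofReal ?_)
      rw [hC0, ← mul_assoc, mul_comm (β ^ s), ← Real.mul_rpow hR.le hβ.le]
      refine mul_le_mul (Real.rpow_le_rpow (le_max_right _ _)
        (max_le (hz.trans (hbu x)) (by positivity)) hs0.le) ?_
        (Finset.sum_nonneg fun y _ => hI x y) (by positivity)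
      exact Finset.single_le_sum (f := fun x => ∑ y, M.K x y *
        ((∫ w, Real.exp (-s * M.γ y w.1) ∂M.ν) * h y))
        (fun x _ => Finset.sum_nonneg fun y _ => hI x y) (Finset.mem_univ x)
    calc ∫⁻ q', ENNReal.ofReal (logLyapunov s β h q') ∂κ (x, z)
        ≤ ∫⁻ q', ENNReal.ofReal (1 / β ^ s) * ENNReal.ofReal (lyapunov s h q') ∂κ (x, z) := by
          refine lintegral_mono fun q' => ?_
          rw [← ENNReal.ofReal_mul (by positivity), one_div_mul_eq_div]
          refine ENNReal.ofReal_le_ofReal ?_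
          have := Real.log_le_sub_one_of_pos (show 0 < 1 + lyapunov s h q' / β ^ s by
            linarith [hW q'])
          rw [logLyapunov]
          linarith
      _ ≤ ENNReal.ofReal (1 / β ^ s) * ENNReal.ofReal (β ^ s * C0) := by
          rw [lintegral_const_mul _ hmeasL.ennreal_ofReal]
          gcongr
      _ = ENNReal.ofReal C0 := by
          rw [← ENNReal.ofReal_mul (by positivity)]
          congr 1
          field_simp

/-- The expected termination time of a sampler whose threshold is of the order `c Δ`. -/
theorem exists_lintegral_terminationTime_le (h1 : M.Assumption1) (h4 : M.Assumption4)
    (hlam : M.RewardNontrivial) (hθ : 0 < θ) (hψ : M.psi θ = 0) (hv : M.IsPerronVector θ v)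
    {R : ℝ} (hR : 0 < R) :
    ∃ p C : ℝ, 0 < p ∧ 0 < C ∧ ∀ (c Δ : ℝ) (b : S → ℝ) (κ : Kernel (S × ℝ) (S × ℝ))
      (hκ : IsMarkovKernel κ), 2 ≤ c → 0 < Δ → (∀ x, c * Δ / R ≤ b x) →
      (∀ x, b x ≤ R * (c * Δ)) → M.IsSampler θ v Δ b κ → ∀ y : S × ℝ,
        ∫⁻ Y, (terminationTime Y : ℝ≥0∞) ∂chainLaw κ hκ y ≤
          ENNReal.ofReal (C * (c ^ p * Real.log c + Real.log (1 + max y.2 0 / (c * Δ)))) := by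
  have hfin := mgfFinite_of_psi_eq_zero hψ
  obtain ⟨r, hr, hneg⟩ := exists_integrable_exp_neg h1
  -- Below `r` for the nominal moment of `exp (-s γ)`, and below `θ` so that `1 - s / θ` lies in
  -- `(0, 1)`.
  set s := min r θ / 2 with hs
  have hmin : 0 < min r θ := lt_min hr hθ
  have hs0 : 0 < s := by positivity
  have hsr : s < r := by have := min_le_left r θ; linarith
  have hsθ : s < θ := by have := min_le_right r θ; linarith
  have hsneg := hneg s hs0 hsr
  have hsfin : M.MgfFinite (θ - s) := fun y =>
    integrable_exp_mul_of_le_of_le (hsneg y) (hfin y) (by linarith) (by linarith)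
  set h : S → ℝ := fun x => v x ^ (-s / θ) with hh_def
  have hh : ∀ x, 0 < h x := fun x => Real.rpow_pos_of_pos (hv.1 x) _
  obtain ⟨ζ, hζ0, hζ1, hdrift⟩ := exists_tilted_drift h4 hθ hψ hv hs0 hsθ
  obtain ⟨p, C1, hp, hC1, hdeath⟩ :=
    exists_death_below hψ hv h1.1 hlam hs0 hζ0 hζ1 hh hsfin hdrift hR
  obtain ⟨k, C2, hk, hC2, hdr⟩ := exists_drift hψ hv hs0 hζ1 hh hsfin hsneg hdrift hR
  set H := ∑ x, h x with hHdef
  have hH : ∀ x, h x ≤ H := fun x =>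
    Finset.single_le_sum (fun x _ => (hh x).le) (Finset.mem_univ x)
  have hH0 : 0 ≤ H := Finset.sum_nonneg fun x _ => (hh x).le
  have hl2 : 0 < Real.log 2 := Real.log_pos one_lt_two
  have hlH : 0 ≤ Real.log (1 + H) := Real.log_nonneg (by linarith)
  -- The three terms pay for the size of `h`, the stay near and below the threshold, and the initial
  -- height.
  refine ⟨p, k⁻¹ * (Real.log (1 + H) / Real.log 2 + C2 * C1 + s), hp, by positivity, ?_⟩
  intro c Δ b κ hκ hc hΔ hbl hbu hsam y
  have hc0 : 0 < c := by linarith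
  have hβ : 0 < c * Δ := by positivity
  obtain ⟨N, hN, hsurv⟩ := hdeath c hc
  have hδ : 0 < c ^ (-p) := by positivity
  have hlc : Real.log 2 ≤ Real.log c := Real.log_le_log two_pos hc
  have hU : Measurable fun q => ENNReal.ofReal (logLyapunov s (c * Δ) h q) := by
    have := measurable_lyapunov s h
    unfold logLyapunov
    fun_prop
  rw [(lintegral_terminationTime _).2]
  refine (tsum_alive_le_of_drift κ hκ y (A := alive S) (D := {q | q.2 ≤ R * (c * Δ)})
    measurableSet_alive hU (k := ENNReal.ofReal k) (c := ENNReal.ofReal C2)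
    (δ := ENNReal.ofReal (c ^ (-p))) (ENNReal.ofReal_pos.2 hk).ne' ENNReal.ofReal_ne_top
    (ENNReal.ofReal_pos.2 hδ).ne' N (fun q => ?_) (fun q hq => ?_)).trans ?_
  · exact (add_le_add (setLIntegral_le_lintegral _ _) le_rfl).trans
      (hdr Δ (c * Δ) b κ hΔ hβ hbl hbu hsam q)
  · exact hsurv Δ b κ hΔ hsam q.1 q.2 hq
  · have hr0 : 0 ≤ max y.2 0 / (c * Δ) := div_nonneg (le_max_right _ _) hβ.le
    have hl0 : 0 ≤ Real.log (1 + max y.2 0 / (c * Δ)) := Real.log_nonneg (by linarith)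
    have hL0 : 0 ≤ logLyapunov s (c * Δ) h y := Real.log_nonneg (by
      have : 0 ≤ lyapunov s h y / (c * Δ) ^ s := div_nonneg (lyapunov_nonneg hh y) (by positivity)
      linarith)
    rw [← ENNReal.ofReal_natCast, ← ENNReal.ofReal_div_of_pos hδ, ← ENNReal.ofReal_inv_of_pos hk,
      ← ENNReal.ofReal_mul (by positivity), ← ENNReal.ofReal_add hL0 (by positivity),
      ← ENNReal.ofReal_mul (by positivity)]
    refine ENNReal.ofReal_le_ofReal ?_
    rw [mul_assoc]
    refine mul_le_mul_of_nonneg_left ?_ (by positivity)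
    have hcp : 1 ≤ c ^ p := Real.one_le_rpow (by linarith) hp.le
    have e1 := logLyapunov_le hs0 hβ hh hH y
    have e2 : C2 / c ^ (-p) * N ≤ C2 * C1 * (c ^ p * Real.log c) := by
      rw [Real.rpow_neg hc0.le, div_inv_eq_mul]
      calc C2 * c ^ p * N ≤ C2 * c ^ p * (C1 * Real.log c) :=
            mul_le_mul_of_nonneg_left hN (by positivity)
        _ = _ := by ring
    have hlc0 : 0 < Real.log c := hl2.trans_le hlc
    have e3 : Real.log (1 + H) ≤ Real.log (1 + H) / Real.log 2 * (c ^ p * Real.log c) := by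
      rw [div_mul_eq_mul_div, le_div_iff₀ hl2]
      refine mul_le_mul_of_nonneg_left (hlc.trans ?_) hlH
      exact le_mul_of_one_le_left hlc0.le hcp
    have e4 : 0 ≤ s * (c ^ p * Real.log c) := by positivity
    have e5 : 0 ≤ (Real.log (1 + H) / Real.log 2 + C2 * C1) *
      Real.log (1 + max y.2 0 / (c * Δ)) := by positivity
    nlinarith

end Model

end Perpetuity

/-! ### Asymptotics of `rho`, `cDelta` and the threshold -/

namespace Perpetuity

lemma tendsto_log_one_div : Tendsto (fun Δ : ℝ => Real.log (1 / Δ)) (𝓝[>] 0) atTop := by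
  simp only [one_div]
  exact Real.tendsto_log_atTop.comp tendsto_inv_nhdsGT_zero

lemma tendsto_rho : Tendsto rho (𝓝[>] 0) (𝓝 0) :=
  (tendsto_inv_atTop_zero.comp tendsto_log_one_div).congr fun _ => (one_div _).symm

lemma rho_pos {Δ : ℝ} (h0 : 0 < Δ) (h1 : Δ < 1) : 0 < rho Δ :=
  one_div_pos.2 (Real.log_pos (by rwa [lt_div_iff₀ h0, one_mul]))

lemma cDelta_pos {θs B₁ B₂ Δ : ℝ} (hB₁ : 0 < B₁) (hB₂ : 0 < B₂) (h0 : 0 < Δ) (h1 : Δ < 1) :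
    0 < cDelta θs B₁ B₂ Δ :=
  mul_pos (div_pos hB₂ hB₁) (Real.rpow_pos_of_pos (rho_pos h0 h1) _)

/-- For `rho Δ < θs` the exponent `1 + 1 / (2 θs - rho Δ)` lies between `1` and `1 + 1 / θs`. -/
lemma cDelta_bounds {θs B₁ B₂ Δ : ℝ} (hθ : 0 < θs) (hB₁ : 0 < B₁) (hB₂ : 0 < B₂)
    (hl : 1 ≤ Real.log (1 / Δ)) (hρ : rho Δ < θs) :
    B₂ / B₁ * Real.log (1 / Δ) ≤ cDelta θs B₁ B₂ Δ ∧
      cDelta θs B₁ B₂ Δ ≤ B₂ / B₁ * Real.log (1 / Δ) ^ (1 + 1 / θs) := by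
  have hl0 : 0 < Real.log (1 / Δ) := by linarith
  have hB : 0 < B₂ / B₁ := by positivity
  have h1 : cDelta θs B₁ B₂ Δ = B₂ / B₁ * Real.log (1 / Δ) ^ (1 + 1 / (2 * θs - rho Δ)) := by
    rw [cDelta]
    nth_rw 1 [rho]
    rw [one_div (Real.log _), Real.inv_rpow hl0.le, Real.rpow_neg hl0.le, inv_inv]
  have h2 : 0 < 1 / (2 * θs - rho Δ) := one_div_pos.2 (by linarith)
  rw [h1]
  constructor
  · refine mul_le_mul_of_nonneg_left ?_ hB.le
    conv_lhs => rw [← Real.rpow_one (Real.log (1 / Δ))]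
    exact Real.rpow_le_rpow_of_exponent_le hl (by linarith)
  · refine mul_le_mul_of_nonneg_left (Real.rpow_le_rpow_of_exponent_le hl ?_) hB.le
    exact add_le_add le_rfl (one_div_le_one_div_of_le hθ (by linarith))

lemma eventually_rho_lt {θs : ℝ} (hθ : 0 < θs) : ∀ᶠ Δ : ℝ in 𝓝[>] 0, rho Δ < θs :=
  tendsto_rho.eventually (gt_mem_nhds hθ)

lemma eventually_two_le_cDelta {θs B₁ B₂ : ℝ} (hθ : 0 < θs) (hB₁ : 0 < B₁) (hB₂ : 0 < B₂) :
    ∀ᶠ Δ : ℝ in 𝓝[>] 0, 2 ≤ cDelta θs B₁ B₂ Δ := by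
  filter_upwards [eventually_rho_lt hθ, tendsto_log_one_div.eventually_ge_atTop 1,
    tendsto_log_one_div.eventually_ge_atTop (2 / (B₂ / B₁))] with Δ h1 h2 h3
  refine le_trans ?_ (cDelta_bounds hθ hB₁ hB₂ h2 h1).1
  rwa [div_le_iff₀' (by positivity)] at h3

/-- With `l = log (1/Δ)` one has `Δ = exp (-l)`, which beats any power of `l`. This makes `log (1 /
(c Δ))` nonnegative. -/
lemma eventually_cDelta_mul_le_one {θs B₁ B₂ : ℝ} (hθ : 0 < θs) (hB₁ : 0 < B₁) (hB₂ : 0 < B₂) :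
    ∀ᶠ Δ : ℝ in 𝓝[>] 0, cDelta θs B₁ B₂ Δ * Δ ≤ 1 := by
  have h := (tendsto_rpow_mul_exp_neg_mul_atTop_nhds_zero (1 + 1 / θs) 1 one_pos).comp
    tendsto_log_one_div
  filter_upwards [eventually_rho_lt hθ, tendsto_log_one_div.eventually_ge_atTop 1,
    h.eventually (gt_mem_nhds (show 0 < (B₂ / B₁)⁻¹ by positivity)),
    self_mem_nhdsWithin] with Δ h1 h2 h3 h4
  have h4 : 0 < Δ := h4
  have h5 : Real.exp (-1 * Real.log (1 / Δ)) = Δ := by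
    rw [one_div, Real.log_inv, neg_one_mul, neg_neg, Real.exp_log h4]
  simp only [Function.comp_apply, h5] at h3
  refine (mul_le_mul_of_nonneg_right (cDelta_bounds hθ hB₁ hB₂ h2 h1).2 h4.le).trans ?_
  rw [mul_assoc]
  have hB : 0 < B₂ / B₁ := by positivity
  calc _ ≤ B₂ / B₁ * (B₂ / B₁)⁻¹ := mul_le_mul_of_nonneg_left h3.le hB.le
    _ = 1 := mul_inv_cancel₀ hB.ne'

/-- The threshold is of the order `c_Δ Δ`. -/
lemma exists_threshold_bounds {S : Type*} [Finite S] {θs : ℝ} {u : ℝ → S → ℝ} (hθ : 0 < θs)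
    (hu : ∀ x, 0 < u θs x) (hcont : ContinuousWithinAt u (Set.Iic θs) θs) {B₁ B₂ : ℝ}
    (hB₁ : 0 < B₁) (hB₂ : 0 < B₂) :
    ∃ R, 0 < R ∧ ∀ᶠ Δ : ℝ in 𝓝[>] 0, ∀ x,
      cDelta θs B₁ B₂ Δ * Δ / R ≤ threshold θs u B₁ B₂ Δ x ∧
        threshold θs u B₁ B₂ Δ x ≤ R * (cDelta θs B₁ B₂ Δ * Δ) := by
  have he : Tendsto (fun Δ => 1 / (2 * θs - rho Δ)) (𝓝[>] 0) (𝓝 (1 / (2 * θs - 0))) :=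
    tendsto_const_nhds.div (tendsto_const_nhds.sub tendsto_rho) (by simpa using hθ.ne')
  have hlt : ∀ᶠ Δ : ℝ in 𝓝[>] 0, Δ < 1 := nhdsWithin_le_nhds (gt_mem_nhds one_pos)
  -- The approach is from the left, the side on which `u` is continuous.
  have hρ : Tendsto (fun Δ => θs - rho Δ) (𝓝[>] 0) (𝓝[≤] θs) := by
    refine tendsto_nhdsWithin_iff.2 ⟨by simpa using tendsto_rho.const_sub θs, ?_⟩
    filter_upwards [self_mem_nhdsWithin, hlt] with Δ h1 h2
    exact (sub_lt_self θs (rho_pos h1 h2)).le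
  set l : S → ℝ := fun x => u θs x ^ (1 / (2 * θs - 0)) * u θs x ^ (1 / (2 * θs - 0)) with hl
  have hl0 : ∀ x, 0 < l x := fun x =>
    mul_pos (Real.rpow_pos_of_pos (hu x) _) (Real.rpow_pos_of_pos (hu x) _)
  have hlim : ∀ x, Tendsto (fun Δ => u θs x ^ (1 / (2 * θs - rho Δ)) *
      u (θs - rho Δ) x ^ (1 / (2 * θs - rho Δ))) (𝓝[>] 0) (𝓝 (l x)) := fun x => by
    have h1 : Tendsto (fun Δ => u (θs - rho Δ) x) (𝓝[>] 0) (𝓝 (u θs x)) :=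
      ((continuous_apply x).tendsto _).comp (hcont.tendsto.comp hρ)
    exact (tendsto_const_nhds.rpow he (Or.inl (hu x).ne')).mul (h1.rpow he (Or.inl (hu x).ne'))
  obtain ⟨m, hm0, hm1, hm⟩ := exists_pos_forall_le hl0
  obtain ⟨m', hm'0, hm'1, hm'⟩ := exists_pos_forall_le fun x => inv_pos.2 (hl0 x)
  -- The factor is eventually in `(l x / 2, 2 * l x)`, with `m ≤ l x ≤ 1 / m'` and `m, m' ≤ 1`.
  refine ⟨2 / (m * m'), by positivity, ?_⟩
  have hev : ∀ᶠ Δ : ℝ in 𝓝[>] 0, ∀ x,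
      l x / 2 < u θs x ^ (1 / (2 * θs - rho Δ)) * u (θs - rho Δ) x ^ (1 / (2 * θs - rho Δ)) ∧
      u θs x ^ (1 / (2 * θs - rho Δ)) * u (θs - rho Δ) x ^ (1 / (2 * θs - rho Δ)) < 2 * l x :=
    eventually_all.2 fun x => (hlim x).eventually ((lt_mem_nhds (by linarith [hl0 x])).and
      (gt_mem_nhds (by linarith [hl0 x])))
  filter_upwards [hev, self_mem_nhdsWithin, hlt] with Δ h1 h2 h3 x
  have hβ : 0 < cDelta θs B₁ B₂ Δ * Δ := mul_pos (cDelta_pos hB₁ hB₂ h2 h3) h2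
  obtain ⟨h4, h5⟩ := h1 x
  rw [threshold, mul_assoc (cDelta θs B₁ B₂ Δ * Δ), div_eq_mul_inv, mul_comm (2 / (m * m'))]
  refine ⟨mul_le_mul_of_nonneg_left (le_trans ?_ h4.le) hβ.le,
    mul_le_mul_of_nonneg_left (h5.le.trans ?_) hβ.le⟩
  · rw [inv_div]
    have := mul_le_of_le_one_right hm0.le hm'1
    linarith [hm x]
  · have e1 : l x ≤ m'⁻¹ := (le_inv_comm₀ hm'0 (hl0 x)).1 (hm' x)
    have e2 : m'⁻¹ ≤ (m * m')⁻¹ :=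
      inv_anti₀ (by positivity) (mul_le_of_le_one_left hm'0.le hm1)
    rw [div_eq_mul_inv]
    linarith

namespace Model

variable {S : Type*} [Fintype S] [DecidableEq S] [MeasurableSpace S] [MeasurableSingletonClass S]
  {M : Model S}

lemma isSampler_samplerKernel (θs : ℝ) (u : ℝ → S → ℝ) (B₁ B₂ Δ : ℝ) :
    M.IsSampler θs (u θs) Δ (threshold θs u B₁ B₂ Δ) (M.samplerKernel θs u B₁ B₂ Δ) where
  tilted x z hz := by
    have h : (x, z) ∈ regionC θs u B₁ B₂ Δ := hz
    rw [samplerKernel, Kernel.coe_mk, if_pos h]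
  nominal x z hz := by
    have h : (x, z) ∉ regionC θs u B₁ B₂ Δ := not_lt.2 hz
    rw [samplerKernel, Kernel.coe_mk, if_neg h]

end Model

end Perpetuity

/-! ### The theorem -/

open Perpetuity

theorem mainTheorem5 {S : Type*} [Fintype S] [DecidableEq S] [MeasurableSpace S]
    [MeasurableSingletonClass S] (M : Perpetuity.Model S) (θs : ℝ)
    (h1 : M.Assumption1) (h2 : M.Assumption2 θs) (h3 : M.Assumption3) (h4 : M.Assumption4)
    (hlam : M.RewardNontrivial)
    -- a choice of the Perron-Frobenius eigenvectors, continuous at the Cramér root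
    (u : ℝ → S → ℝ) (hu : ∀ θ, 0 < θ → θ ≤ θs → M.IsPerronVector θ (u θ))
    (hcont : ContinuousWithinAt u (Set.Iic θs) θs)
    (B₁ B₂ : ℝ) (hB₁ : 0 < B₁) (hB₂ : 0 < B₂) :
    (∀ Δ : ℝ, 0 < Δ → Δ < 1 → Perpetuity.rho Δ < θs → ∀ y : S × ℝ,
      ∀ᵐ Y ∂(M.samplerLaw h2.2.1 (hu θs h2.1 le_rfl) B₁ B₂ Δ y), Perpetuity.terminationTime Y < ⊤) ∧
    (∃ p : ℝ, 0 < p ∧ ∀ y : S × ℝ, ∃ A : ℝ, ∀ᶠ Δ : ℝ in 𝓝[>] 0,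
      ∫⁻ Y, (Perpetuity.terminationTime Y : ℝ≥0∞) ∂(M.samplerLaw h2.2.1 (hu θs h2.1 le_rfl) B₁ B₂ Δ y) ≤
        ENNReal.ofReal (A *
          (Perpetuity.cDelta θs B₁ B₂ Δ ^ p * Real.log (Perpetuity.cDelta θs B₁ B₂ Δ) +
            Real.log (1 / (Perpetuity.cDelta θs B₁ B₂ Δ * Δ))))) ∧
    (∃ q : ℝ, 0 < q ∧ ∀ y : S × ℝ, ∃ A : ℝ, ∀ᶠ Δ : ℝ in 𝓝[>] 0,
      ∫⁻ Y, (Perpetuity.terminationTime Y : ℝ≥0∞) ∂(M.samplerLaw h2.2.1 (hu θs h2.1 le_rfl) B₁ B₂ Δ y) ≤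
        ENNReal.ofReal (A * Real.log (1 / Δ) ^ q)) := by
  have hθ := h2.1
  have hv := hu θs hθ le_rfl
  refine ⟨fun Δ hΔ0 hΔ1 hρ y => ?_, ?_⟩
  · have hb : ∀ x, 0 < threshold θs u B₁ B₂ Δ x := fun x =>
      mul_pos (mul_pos (mul_pos (cDelta_pos hB₁ hB₂ hΔ0 hΔ1) hΔ0)
        (Real.rpow_pos_of_pos (hv.1 x) _)) (Real.rpow_pos_of_pos
          ((hu (θs - rho Δ) (by linarith) (by linarith [rho_pos hΔ0 hΔ1])).1 x) _)
    obtain ⟨m, hm0, -, hm⟩ := exists_pos_forall_le hb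
    obtain ⟨m', hm'0, -, hm'⟩ := exists_pos_forall_le fun x => inv_pos.2 (hb x)
    -- For a fixed `Δ`, `c_Δ` may be less than `2`. Only finiteness matters, so the bound is used
    -- with `c = 2` and an `R` adapted to this `Δ`.
    set R := max (2 * Δ / m) (1 / (m' * (2 * Δ))) with hR
    have hR0 : 0 < R := lt_max_of_lt_left (by positivity)
    obtain ⟨p, C, -, -, hmain⟩ := Model.exists_lintegral_terminationTime_le h1 h4 hlam hθ h2.2.1
      hv hR0
    have hle := hmain 2 Δ (threshold θs u B₁ B₂ Δ) (M.samplerKernel θs u B₁ B₂ Δ)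
      (M.isMarkovKernel_samplerKernel h2.2.1 hv B₁ B₂ Δ) le_rfl hΔ0 (fun x => ?_) (fun x => ?_)
      (Model.isSampler_samplerKernel θs u B₁ B₂ Δ) y
    · filter_upwards [ae_lt_top' (lintegral_terminationTime _).1
        (ne_top_of_le_ne_top ENNReal.ofReal_ne_top hle)] with Y hY
      simpa using hY
    · rw [div_le_comm₀ hR0 (hb x)]
      exact (div_le_div_of_nonneg_left (by positivity) hm0 (hm x)).trans (le_max_left _ _)
    · have e1 : 1 / (m' * (2 * Δ)) * (2 * Δ) ≤ R * (2 * Δ) :=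
        mul_le_mul_of_nonneg_right (le_max_right _ _) (by positivity)
      have e2 : 1 / (m' * (2 * Δ)) * (2 * Δ) = 1 / m' := by field_simp
      have e3 : threshold θs u B₁ B₂ Δ x ≤ 1 / m' := by
        rw [one_div]
        exact (le_inv_comm₀ hm'0 (hb x)).1 (hm' x)
      linarith
  obtain ⟨R, hR, hthr⟩ := exists_threshold_bounds hθ hv.1 hcont hB₁ hB₂
  obtain ⟨p, C, hp, hC, hmain⟩ := Model.exists_lintegral_terminationTime_le h1 h4 hlam hθ h2.2.1
    hv hR
  have hl2 : 0 < Real.log 2 := Real.log_pos one_lt_two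
  have key : ∀ y : S × ℝ, ∃ A : ℝ, 0 ≤ A ∧ ∀ᶠ Δ : ℝ in 𝓝[>] 0,
      ∫⁻ Y, (terminationTime Y : ℝ≥0∞) ∂(M.samplerLaw h2.2.1 hv B₁ B₂ Δ y) ≤
        ENNReal.ofReal (A * (cDelta θs B₁ B₂ Δ ^ p * Real.log (cDelta θs B₁ B₂ Δ) +
            Real.log (1 / (cDelta θs B₁ B₂ Δ * Δ)))) := by
    intro y
    set z := max y.2 0 with hz
    have hz0 : 0 ≤ z := le_max_right _ _
    have hlz : 0 ≤ Real.log (1 + z) := Real.log_nonneg (by linarith)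
    -- The starting height enters only through this constant: `log (1 + z)` is absorbed by `c ^ p *
    -- log c ≥ log 2`.
    refine ⟨C * (1 + Real.log (1 + z) / Real.log 2), by positivity, ?_⟩
    filter_upwards [hthr, eventually_two_le_cDelta hθ hB₁ hB₂,
      eventually_cDelta_mul_le_one hθ hB₁ hB₂, self_mem_nhdsWithin] with Δ e1 e2 e3 e4
    have e4 : 0 < Δ := e4
    refine (hmain _ Δ (threshold θs u B₁ B₂ Δ) (M.samplerKernel θs u B₁ B₂ Δ)
      (M.isMarkovKernel_samplerKernel h2.2.1 hv B₁ B₂ Δ) e2 e4 (fun x => (e1 x).1)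
      (fun x => (e1 x).2) (Model.isSampler_samplerKernel θs u B₁ B₂ Δ) y).trans
      (ENNReal.ofReal_le_ofReal ?_)
    set c := cDelta θs B₁ B₂ Δ with hc
    have hc0 : 0 < c := by linarith
    have hβ : 0 < c * Δ := by positivity
    have f1 : Real.log (1 + z / (c * Δ)) ≤ Real.log (1 + z) + Real.log (1 / (c * Δ)) := by
      rw [← Real.log_mul (by positivity) (by positivity)]
      refine Real.log_le_log (by positivity) ?_
      rw [mul_one_div, add_div]
      exact add_le_add ((one_le_div hβ).2 e3) le_rfl
    have hlc : Real.log 2 ≤ Real.log c := Real.log_le_log two_pos e2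
    have hcp : 1 ≤ c ^ p := Real.one_le_rpow (by linarith) hp.le
    have f2 : Real.log 2 ≤ c ^ p * Real.log c :=
      hlc.trans (le_mul_of_one_le_left (by linarith) hcp)
    have f3 : Real.log (1 + z) ≤ Real.log (1 + z) / Real.log 2 * (c ^ p * Real.log c) := by
      rw [div_mul_eq_mul_div, le_div_iff₀ hl2]
      exact mul_le_mul_of_nonneg_left f2 hlz
    have f4 : 0 ≤ Real.log (1 / (c * Δ)) := Real.log_nonneg ((one_le_div hβ).2 e3)
    have f5 : 0 ≤ Real.log (1 + z) / Real.log 2 * Real.log (1 / (c * Δ)) := by positivity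
    rw [mul_assoc]
    refine mul_le_mul_of_nonneg_left ?_ hC.le
    linarith
  refine ⟨⟨p, hp, fun y => (key y).imp fun A hA => hA.2⟩,
    -- `c ^ p * log c ≤ c ^ (p + 1)`, and `c` is at most a constant times `log (1/Δ) ^ (1 + 1 /
    -- θs)`.
    (1 + 1 / θs) * (p + 1), by positivity, fun y => ?_⟩
  obtain ⟨A, hA0, hA⟩ := key y
  refine ⟨A * ((B₂ / B₁) ^ (p + 1) + 1), ?_⟩
  filter_upwards [hA, eventually_two_le_cDelta hθ hB₁ hB₂, eventually_rho_lt hθ,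
    tendsto_log_one_div.eventually_ge_atTop 1, self_mem_nhdsWithin] with Δ e1 e2 e3 e4 e5
  have e5 : 0 < Δ := e5
  refine e1.trans (ENNReal.ofReal_le_ofReal ?_)
  set c := cDelta θs B₁ B₂ Δ with hc
  set l := Real.log (1 / Δ) with hl
  have hc0 : 0 < c := by linarith
  have hl0 : 0 < l := by linarith
  have g1 : c ^ p * Real.log c ≤ c ^ (p + 1) := by
    rw [Real.rpow_add hc0, Real.rpow_one]
    exact mul_le_mul_of_nonneg_left (Real.log_le_self hc0.le) (by positivity)
  have g2 : c ^ (p + 1) ≤ (B₂ / B₁) ^ (p + 1) * l ^ ((1 + 1 / θs) * (p + 1)) := by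
    rw [Real.rpow_mul hl0.le, ← Real.mul_rpow (by positivity) (by positivity)]
    exact Real.rpow_le_rpow hc0.le (cDelta_bounds hθ hB₁ hB₂ e4 e3).2 (by positivity)
  have g3 : Real.log (1 / (c * Δ)) ≤ l := by
    refine Real.log_le_log (by positivity) (one_div_le_one_div_of_le e5 ?_)
    exact le_mul_of_one_le_left e5.le (by linarith)
  have g4 : l ≤ l ^ ((1 + 1 / θs) * (p + 1)) := by
    conv_lhs => rw [← Real.rpow_one l]
    refine Real.rpow_le_rpow_of_exponent_le e4 ?_
    have : 0 < 1 / θs := by positivity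
    nlinarith
  rw [mul_assoc]
  refine mul_le_mul_of_nonneg_left ?_ hA0
  rw [add_mul, one_mul]
  linarith
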